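/- Let $\mathbb K$ be a field of characteristic $0$, let $n\ge 1$, and let $S=\mathbb K[p_1,\dots,p_n,q_1,\dots,q_n]=\bigoplus_{\ell\ge 0}S^\ell$, where $S^\ell$ is the space of homogeneous polynomials of degree $\ell$. Let $m(F\otimes G)=FG$ be the commutative product, let $\wp$ be the operator of $S\otimes S$ defined by $$\wp(F\otimes G)=\sum_{i=1}^n\Big(\frac{\partial F}{\partial p_i}\otimes\frac{\partial G}{\partial q_i}-\frac{\partial F}{\partial q_i}\otimes\frac{\partial G}{\partial p_i}\Big),$$ and put $$C_k(F,G)=\frac{1}{2^k k!}\,m\big(\wp^k(F\otimes G)\big)\quad(k\ge 0),\qquad F\star G=\sum_{k\ge 0}C_k(F,G).$$ The space $S$ with the associative product $\star$ is the Weyl algebra $W$. It is a Lie algebra with bracket $[F,G]_{\mathcal L}=F\star G-G\star F$, and a Lie superalgebra with the bilinear bracket given by $[F,G]=F\star G-(-1)^{fg}\,G\star F$ for $F\in S^f$, $G\in S^g$. The subspace $S^2$ is a Lie subalgebra for $[\cdot,\cdot]_{\mathcal L}$, identified with $\mathfrak g_{\bar 0}=\mathfrak{sp}(2n)$ through its action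 $X\mapsto [X,\cdot]_{\mathcal L}|_{S^1}$ on $S^1$. It acts on $W$ by $\mathrm{ad}(X)(F)=[X,F]=[X,F]_{\mathcal L}$, and each $S^\ell$ is a submodule. For a bilinear map $\beta$ on $W$, write $\beta(S^\ell,S^m)$ for the span of all $\beta(F,G)$ with $F\in S^\ell$, $G\in S^m$; the notations $S^\ell\star S^m$, $[S^\ell,S^m]_{\mathcal L}$ and $[S^\ell,S^m]$ are understood in this way. **Theorem 3.1.** For all integers $\ell,m\ge 0$, with respect to this $\mathrm{ad}$-action of $\mathfrak g_{\bar 0}$: 1. The map $F\otimes G\mapsto F\star G$ is a homomorphism of $\mathfrak g_{\bar 0}$-modules from $S^\ell\otimes S^m$ onto $\bigoplus_{k=0}^{\min(\ell,m)}S^{\ell+m-2k}$; hence $$S^\ell\star S^m=\bigoplus_{k=0}^{\min(\ell,m)}S^{\ell+m-2k}.$$ 2. The map $F\otimes G\mapsto [F,G]_{\mathcal L}$ is a homomorphism of $\mathfrak g_{\bar 0}$-modules from $S^\ell\otimes S^m$ onto $\bigoplus_{p\ge 0,\ 2p+1\le\min(\ell,m)}S^{\ell+m-2(2p+1)}$;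 hence $$[S^\ell,S^m]_{\mathcal L}=\bigoplus_{p\ge 0,\ 2p+1\le\min(\ell,m)}S^{\ell+m-2(2p+1)}.$$ 3. The map $F\otimes G\mapsto [F,G]$ is a homomorphism of $\mathfrak g_{\bar 0}$-modules from $S^\ell\otimes S^m$ onto $$[S^\ell,S^m]=\begin{cases}\displaystyle\bigoplus_{p\ge 0,\ 2p+1\le\min(\ell,m)}S^{\ell+m-2(2p+1)}&\text{if }\ell m\text{ is even},\\[2ex]\displaystyle\bigoplus_{p\ge 0,\ 2p\le\min(\ell,m)}S^{\ell+m-4p}&\text{if }\ell m\text{ is odd}.\end{cases}$$ 4. For every $k\ge 0$, the map $F\otimes G\mapsto C_k(F,G)$ is a homomorphism of $\mathfrak g_{\bar 0}$-modules from $S^\ell\otimes S^m$ into $S^{\ell+m-2k}$ (where $S^r=\{0\}$ for $r<0$), and $$C_k(S^\ell,S^m)=\begin{cases}S^{\ell+m-2k}&\text{if }k\le\min(\ell,m),\\ \{0\}&\text{if }k>\min(\ell,m).\end{cases}$$ -/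

import Mathlib

open scoped TensorProduct

set_option linter.unusedSectionVars false

noncomputable section

namespace MoyalWeyl

variable (K : Type*) [Field K] (n : ℕ)

/-- The commutative algebra `S = Sym(V*) = K[p₁, …, pₙ, q₁, …, qₙ]`;
`X (Sum.inl i)` is `p_i` and `X (Sum.inr i)` is `q_i`. -/
abbrev PolyAlg : Type _ := MvPolynomial (Fin n ⊕ Fin n) K

/-- The partial derivative with respect to a coordinate, as a linear map of `S`. -/
abbrev dd (j : Fin n ⊕ Fin n) : PolyAlg K n →ₗ[K] PolyAlg K n :=
  (MvPolynomial.pderiv j : Derivation K (PolyAlg K n) (PolyAlg K n)).toLinearMap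

/-- The operator
`℘ (F ⊗ G) = ∑ i, (∂F/∂p_i ⊗ ∂G/∂q_i - ∂F/∂q_i ⊗ ∂G/∂p_i)` of `S ⊗ S`. -/
def wp : (PolyAlg K n ⊗[K] PolyAlg K n) →ₗ[K] (PolyAlg K n ⊗[K] PolyAlg K n) :=
  ∑ i : Fin n,
    (TensorProduct.map (dd K n (Sum.inl i)) (dd K n (Sum.inr i))
      - TensorProduct.map (dd K n (Sum.inr i)) (dd K n (Sum.inl i)))

/-- The coefficients `C_k = (1 / (2 ^ k k!)) m ∘ ℘ ^ k` of the Moyal product, as linear maps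
on `S ⊗ S`; here `m` is the commutative product of `S`. -/
def moyalCoeff (k : ℕ) : (PolyAlg K n ⊗[K] PolyAlg K n) →ₗ[K] PolyAlg K n :=
  (1 / ((2 : K) ^ k * (k.factorial : K))) • (LinearMap.mul' K (PolyAlg K n) ∘ₗ (wp K n ^ k))

variable {K n}

/-- The derivation `{x_j, ·}` of `S`, for a coordinate `x_j`. -/
def ham : Fin n ⊕ Fin n → Derivation K (PolyAlg K n) (PolyAlg K n)
  | Sum.inl i => MvPolynomial.pderiv (Sum.inr i)
  | Sum.inr i => - MvPolynomial.pderiv (Sum.inl i)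

theorem wp_tmul (F G : PolyAlg K n) :
    wp K n (F ⊗ₜ G) = ∑ i : Fin n,
      (MvPolynomial.pderiv (Sum.inl i) F ⊗ₜ MvPolynomial.pderiv (Sum.inr i) G
        - MvPolynomial.pderiv (Sum.inr i) F ⊗ₜ[K] MvPolynomial.pderiv (Sum.inl i) G) := by
  simp [wp, LinearMap.sum_apply]

theorem pderiv_comm (i j : Fin n ⊕ Fin n) (F : PolyAlg K n) :
    MvPolynomial.pderiv i (MvPolynomial.pderiv j F)
      = MvPolynomial.pderiv j (MvPolynomial.pderiv i F) := by
  have h : ⁅(MvPolynomial.pderiv i : Derivation K (PolyAlg K n) (PolyAlg K n)),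
      (MvPolynomial.pderiv j : Derivation K (PolyAlg K n) (PolyAlg K n))⁆ = 0 := by
    apply MvPolynomial.derivation_ext
    intro l
    classical
    rw [Derivation.commutator_apply, MvPolynomial.pderiv_X, MvPolynomial.pderiv_X]
    by_cases h1 : l = i <;> by_cases h2 : l = j <;> simp [Pi.single_apply, h1, h2] <;>
      split_ifs <;> simp
  have := congrArg (fun D => D F) h
  simpa [Derivation.commutator_apply, sub_eq_zero] using this

theorem ham_pderiv (j i : Fin n ⊕ Fin n) (F : PolyAlg K n) :
    ham j (MvPolynomial.pderiv i F) = MvPolynomial.pderiv i (ham j F) := by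
  cases j <;> simp [ham, pderiv_comm i]

theorem ham_comm (j i : Fin n ⊕ Fin n) (F : PolyAlg K n) :
    ham j (ham i F) = ham i (ham j F) := by
  rcases i with i | i
  · exact ham_pderiv j _ F
  · change ham j (- MvPolynomial.pderiv (Sum.inl i) F)
      = - MvPolynomial.pderiv (Sum.inl i) (ham j F)
    rw [map_neg, ham_pderiv]

theorem wp_X_mul_tmul (j : Fin n ⊕ Fin n) (F G : PolyAlg K n) :
    wp K n ((MvPolynomial.X j * F) ⊗ₜ G)
      = TensorProduct.map (LinearMap.mulLeft K (MvPolynomial.X j)) LinearMap.id (wp K n (F ⊗ₜ G))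
        + F ⊗ₜ ham j G := by
  classical
  rw [wp_tmul, wp_tmul, map_sum]
  have key : F ⊗ₜ[K] ham j G = ∑ i : Fin n,
      ((Pi.single (M := fun _ => PolyAlg K n) (Sum.inl i) 1 j * F)
        ⊗ₜ[K] MvPolynomial.pderiv (Sum.inr i) G
       - (Pi.single (M := fun _ => PolyAlg K n) (Sum.inr i) 1 j * F)
        ⊗ₜ[K] MvPolynomial.pderiv (Sum.inl i) G) := by
    rcases j with j | j
    · rw [Finset.sum_eq_single j]
      · simp [ham]
      · intro b _ hb; simp [hb.symm]
      · simp
    · rw [Finset.sum_eq_single j]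
      · simp [ham, TensorProduct.tmul_neg]
      · intro b _ hb; simp [hb.symm]
      · simp
  rw [key, ← Finset.sum_add_distrib]
  refine Finset.sum_congr rfl fun i _ => ?_
  simp only [Derivation.leibniz, MvPolynomial.pderiv_X, smul_eq_mul, map_sub,
    TensorProduct.map_tmul, LinearMap.mulLeft_apply, LinearMap.id_apply, TensorProduct.add_tmul]
  simp only [mul_comm F]
  abel

/-- `x_j ⊗ 1`, as an operator on `S ⊗ S`. -/
abbrev mx (j : Fin n ⊕ Fin n) :
    (PolyAlg K n ⊗[K] PolyAlg K n) →ₗ[K] (PolyAlg K n ⊗[K] PolyAlg K n) :=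
  TensorProduct.map (LinearMap.mulLeft K (MvPolynomial.X j)) LinearMap.id

/-- `1 ⊗ {x_j, ·}`, as an operator on `S ⊗ S`. -/
abbrev hr (j : Fin n ⊕ Fin n) :
    (PolyAlg K n ⊗[K] PolyAlg K n) →ₗ[K] (PolyAlg K n ⊗[K] PolyAlg K n) :=
  TensorProduct.map LinearMap.id (ham j).toLinearMap

/-- `{x_j, ·} ⊗ 1`, as an operator on `S ⊗ S`. -/
abbrev hl (j : Fin n ⊕ Fin n) :
    (PolyAlg K n ⊗[K] PolyAlg K n) →ₗ[K] (PolyAlg K n ⊗[K] PolyAlg K n) :=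
  TensorProduct.map (ham j).toLinearMap LinearMap.id

/-- The twist of `S ⊗ S`. -/
abbrev tw : (PolyAlg K n ⊗[K] PolyAlg K n) →ₗ[K] (PolyAlg K n ⊗[K] PolyAlg K n) :=
  (TensorProduct.comm K (PolyAlg K n) (PolyAlg K n)).toLinearMap

theorem wp_mx (j : Fin n ⊕ Fin n) : wp K n * mx j = mx j * wp K n + hr j := by
  apply TensorProduct.ext'
  intro F G
  simpa [Module.End.mul_apply] using wp_X_mul_tmul j F G

theorem wp_hr (j : Fin n ⊕ Fin n) : wp K n * hr j = hr j * wp K n := by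
  apply TensorProduct.ext'
  intro F G
  simp [Module.End.mul_apply, wp_tmul, ham_pderiv]

theorem wp_hl (j : Fin n ⊕ Fin n) : wp K n * hl j = hl j * wp K n := by
  apply TensorProduct.ext'
  intro F G
  simp [Module.End.mul_apply, wp_tmul, ham_pderiv]

theorem wp_tw : wp K n * tw = (-1 : K) • (tw * wp K n) := by
  apply TensorProduct.ext'
  intro F G
  simp [Module.End.mul_apply, wp_tmul]

theorem wp_pow_mx (j : Fin n ⊕ Fin n) (k : ℕ) :
    wp K n ^ (k + 1) * mx j = mx j * wp K n ^ (k + 1) + ((k + 1 : ℕ) : K) • (hr j * wp K n ^ k) := by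
  have hc : ∀ k, wp K n ^ k * hr j = hr j * wp K n ^ k := fun k =>
    ((show Commute (wp K n) (hr j) from wp_hr j).pow_left k).eq
  induction k with
  | zero => simp [wp_mx]
  | succ k ih =>
    rw [pow_succ (wp K n) (k + 1), mul_assoc, wp_mx, mul_add, ← mul_assoc, ih, add_mul, mul_assoc,
      ← pow_succ, smul_mul_assoc, mul_assoc, ← pow_succ, hc, add_assoc]
    congr 1
    push_cast
    module

theorem wp_pow_tw (k : ℕ) : wp K n ^ k * tw = ((-1 : K) ^ k) • (tw * wp K n ^ k) := by
  induction k with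
  | zero => simp
  | succ k ih =>
    rw [pow_succ, mul_assoc, wp_tw, mul_smul_comm, ← mul_assoc, ih, smul_mul_assoc, mul_assoc,
      ← pow_succ, smul_smul, pow_succ' (-1 : K)]

theorem wp_pow_C_tmul (a : K) (G : PolyAlg K n) (k : ℕ) :
    (wp K n ^ (k + 1)) (MvPolynomial.C a ⊗ₜ G) = 0 := by
  rw [pow_succ, Module.End.mul_apply, wp_tmul]
  simp

/-- `℘` is locally nilpotent. -/
theorem exists_wp_pow_eq_zero (z : PolyAlg K n ⊗[K] PolyAlg K n) :
    ∃ N : ℕ, ∀ k, N ≤ k → (wp K n ^ k) z = 0 := by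
  induction z with
  | zero => exact ⟨0, fun k _ => map_zero _⟩
  | add x y hx hy =>
    obtain ⟨N, hN⟩ := hx
    obtain ⟨M, hM⟩ := hy
    exact ⟨max N M, fun k hk => by
      rw [map_add, hN k (le_trans (le_max_left _ _) hk), hM k (le_trans (le_max_right _ _) hk),
        add_zero]⟩
  | tmul F G =>
    suffices h : ∃ N : ℕ, ∀ G : PolyAlg K n, ∀ k, N ≤ k → (wp K n ^ k) (F ⊗ₜ G) = 0 by
      obtain ⟨N, hN⟩ := h
      exact ⟨N, hN G⟩
    induction F using MvPolynomial.induction_on with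
    | C a =>
      refine ⟨1, fun G k hk => ?_⟩
      obtain ⟨k, rfl⟩ := Nat.exists_eq_add_of_le' hk
      exact wp_pow_C_tmul a G k
    | add F F' h h' =>
      obtain ⟨N, hN⟩ := h
      obtain ⟨M, hM⟩ := h'
      refine ⟨max N M, fun G k hk => ?_⟩
      rw [TensorProduct.add_tmul, map_add, hN G k (le_trans (le_max_left _ _) hk),
        hM G k (le_trans (le_max_right _ _) hk), add_zero]
    | mul_X F j h =>
      obtain ⟨N, hN⟩ := h
      refine ⟨N + 1, fun G k hk => ?_⟩
      obtain ⟨k, rfl⟩ := Nat.exists_eq_add_of_le' hk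
      have := congrArg (fun f => f (F ⊗ₜ[K] G)) (wp_pow_mx j (N + k))
      rw [mul_comm F]
      simp only [Module.End.mul_apply, LinearMap.add_apply, LinearMap.smul_apply,
        TensorProduct.map_tmul, LinearMap.mulLeft_apply, LinearMap.id_apply] at this
      rw [show k + (N + 1) = N + k + 1 by ring, this, hN G _ (by omega), hN G _ (by omega)]
      simp

theorem moyalCoeff_finite (z : PolyAlg K n ⊗[K] PolyAlg K n) :
    (Function.support fun k => moyalCoeff K n k z).Finite := by
  obtain ⟨N, hN⟩ := exists_wp_pow_eq_zero z
  refine (Set.finite_lt_nat N).subset fun k hk => ?_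
  by_contra h
  apply hk
  simp [moyalCoeff, hN k (not_lt.mp h)]

variable (K n) in
/-- The Moyal product (at `t = 1`) as a linear map on `S ⊗ S`:
`F ⋆ G = m (∑ k, (1 / (2 ^ k k!)) ℘ ^ k (F ⊗ G)) = ∑ k, C_k (F, G)`,
a sum with finitely many nonzero terms. -/
def moyal : (PolyAlg K n ⊗[K] PolyAlg K n) →ₗ[K] PolyAlg K n where
  toFun z := ∑ᶠ k, moyalCoeff K n k z
  map_add' z w := by
    simp only [map_add]
    exact finsum_add_distrib (moyalCoeff_finite z) (moyalCoeff_finite w)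
  map_smul' c z := by
    simp only [map_smul, RingHom.id_apply]
    exact (smul_finsum' c (moyalCoeff_finite z)).symm

theorem moyal_eq_sum (z : PolyAlg K n ⊗[K] PolyAlg K n) :
    ∃ N, ∀ M, N ≤ M → moyal K n z = ∑ k ∈ Finset.range M, moyalCoeff K n k z := by
  obtain ⟨N, hN⟩ := exists_wp_pow_eq_zero z
  refine ⟨N, fun M hM => finsum_eq_sum_of_support_subset _ fun k hk => ?_⟩
  simp only [Finset.coe_range, Set.mem_Iio]
  by_contra h
  apply hk
  simp [moyalCoeff, hN k (le_trans hM (not_lt.mp h))]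

theorem moyal_C_tmul (a : K) (G : PolyAlg K n) :
    moyal K n (MvPolynomial.C a ⊗ₜ G) = MvPolynomial.C a * G := by
  obtain ⟨N, hN⟩ := moyal_eq_sum (MvPolynomial.C a ⊗ₜ[K] G)
  rw [hN (N + 1) (Nat.le_succ N), Finset.sum_range_succ']
  simp [moyalCoeff, wp_pow_C_tmul]

theorem moyal_tmul_C (F : PolyAlg K n) (a : K) :
    moyal K n (F ⊗ₜ MvPolynomial.C a) = F * MvPolynomial.C a := by
  have h : ∀ k, (wp K n ^ (k + 1)) (F ⊗ₜ MvPolynomial.C a) = 0 := fun k => by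
    rw [pow_succ, Module.End.mul_apply, wp_tmul]
    simp
  obtain ⟨N, hN⟩ := moyal_eq_sum (F ⊗ₜ[K] MvPolynomial.C a)
  rw [hN (N + 1) (Nat.le_succ N), Finset.sum_range_succ']
  simp [moyalCoeff, h]

theorem ham_mul' (j : Fin n ⊕ Fin n) (w : PolyAlg K n ⊗[K] PolyAlg K n) :
    ham j (LinearMap.mul' K (PolyAlg K n) w)
      = LinearMap.mul' K (PolyAlg K n) (hl j w + hr j w) := by
  induction w with
  | zero => simp
  | add x y hx hy => simp only [map_add, hx, hy]; ring
  | tmul F G => simp [mul_comm, add_comm]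

theorem ham_moyal (j : Fin n ⊕ Fin n) (z : PolyAlg K n ⊗[K] PolyAlg K n) :
    ham j (moyal K n z) = moyal K n (hl j z) + moyal K n (hr j z) := by
  obtain ⟨N₁, h₁⟩ := moyal_eq_sum (hl j z)
  obtain ⟨N₂, h₂⟩ := moyal_eq_sum z
  obtain ⟨N₃, h₃⟩ := moyal_eq_sum (hr j z)
  have hc : ∀ k, (wp K n ^ k) (hr j z) = hr j ((wp K n ^ k) z) := fun k =>
    congrArg (fun f => f z) ((show Commute (wp K n) (hr j) from wp_hr j).pow_left k).eq
  have hc' : ∀ k, (wp K n ^ k) (hl j z) = hl j ((wp K n ^ k) z) := fun k =>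
    congrArg (fun f => f z) ((show Commute (wp K n) (hl j) from wp_hl j).pow_left k).eq
  rw [h₁ (N₁ + N₂ + N₃) (by omega), h₂ (N₁ + N₂ + N₃) (by omega), h₃ (N₁ + N₂ + N₃) (by omega),
    map_sum, ← Finset.sum_add_distrib]
  refine Finset.sum_congr rfl fun k _ => ?_
  simp only [moyalCoeff, LinearMap.smul_apply, LinearMap.comp_apply, hc, hc']
  rw [Derivation.map_smul, ham_mul', map_add, smul_add]

variable [CharZero K]

theorem moyalCoeff_mx (j : Fin n ⊕ Fin n) (z : PolyAlg K n ⊗[K] PolyAlg K n) (k : ℕ) :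
    moyalCoeff K n (k + 1) (mx j z) = MvPolynomial.X j * moyalCoeff K n (k + 1) z
      + (1 / 2 : K) • moyalCoeff K n k (hr j z) := by
  have hm : ∀ w : PolyAlg K n ⊗[K] PolyAlg K n, LinearMap.mul' K (PolyAlg K n) (mx j w)
      = MvPolynomial.X j * LinearMap.mul' K (PolyAlg K n) w := by
    intro w
    induction w with
    | zero => simp
    | add x y hx hy => rw [map_add, map_add, map_add, hx, hy, mul_add]
    | tmul F G => simp [mul_assoc]
  have hc : (wp K n ^ k) (hr j z) = hr j ((wp K n ^ k) z) :=
    congrArg (fun f => f z) ((show Commute (wp K n) (hr j) from wp_hr j).pow_left k).eq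
  have h := congrArg (fun f => f z) (wp_pow_mx (K := K) j k)
  simp only [Module.End.mul_apply, LinearMap.add_apply, LinearMap.smul_apply] at h
  simp only [moyalCoeff, LinearMap.smul_apply, LinearMap.comp_apply]
  rw [h, map_add, hm, hc, map_smul, smul_add, mul_smul_comm, smul_smul, smul_smul]
  congr 2
  have : ((k + 1 : ℕ) : K) ≠ 0 := Nat.cast_ne_zero.mpr k.succ_ne_zero
  have : (k.factorial : K) ≠ 0 := Nat.cast_ne_zero.mpr k.factorial_ne_zero
  rw [Nat.factorial_succ, pow_succ]
  push_cast at *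
  field_simp

theorem moyal_mx (j : Fin n ⊕ Fin n) (z : PolyAlg K n ⊗[K] PolyAlg K n) :
    moyal K n (mx j z) = MvPolynomial.X j * moyal K n z + (1 / 2 : K) • moyal K n (hr j z) := by
  obtain ⟨N₁, h₁⟩ := moyal_eq_sum (mx j z)
  obtain ⟨N₂, h₂⟩ := moyal_eq_sum z
  obtain ⟨N₃, h₃⟩ := moyal_eq_sum (hr j z)
  have hz : moyalCoeff K n 0 (mx j z) = MvPolynomial.X j * moyalCoeff K n 0 z := by
    clear h₁ h₂ h₃
    induction z with
    | zero => simp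
    | add x y hx hy =>
      rw [map_add, map_add, map_add, mul_add, hx, hy]
    | tmul F G => simp [moyalCoeff, mul_assoc]
  rw [h₁ (N₁ + N₂ + N₃ + 1) (by omega), h₂ (N₁ + N₂ + N₃ + 1) (by omega),
    h₃ (N₁ + N₂ + N₃) (by omega), Finset.sum_range_succ', Finset.sum_range_succ', hz, mul_add,
    Finset.mul_sum, Finset.smul_sum]
  simp only [moyalCoeff_mx, Finset.sum_add_distrib]
  ring

theorem moyal_X_tmul (j : Fin n ⊕ Fin n) (G : PolyAlg K n) :
    moyal K n (MvPolynomial.X j ⊗ₜ G) = MvPolynomial.X j * G + (1 / 2 : K) • ham j G := by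
  have h := moyal_mx j ((1 : PolyAlg K n) ⊗ₜ[K] G)
  have h1 : ∀ G : PolyAlg K n, moyal K n ((1 : PolyAlg K n) ⊗ₜ[K] G) = G := fun G => by
    simpa using moyal_C_tmul (1 : K) G
  simpa [h1] using h

theorem moyal_tmul_X (F : PolyAlg K n) (j : Fin n ⊕ Fin n) :
    moyal K n (F ⊗ₜ MvPolynomial.X j) = MvPolynomial.X j * F - (1 / 2 : K) • ham j F := by
  have e : ∀ k, moyalCoeff K n k (F ⊗ₜ MvPolynomial.X j)
      = (-1 : K) ^ k • moyalCoeff K n k (MvPolynomial.X j ⊗ₜ F) := fun k => by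
    have hm : ∀ w : PolyAlg K n ⊗[K] PolyAlg K n, LinearMap.mul' K (PolyAlg K n) (tw w)
        = LinearMap.mul' K (PolyAlg K n) w := by
      intro w
      induction w with
      | zero => simp
      | add x y hx hy => rw [map_add, map_add, map_add, hx, hy]
      | tmul F G => simp [mul_comm]
    have h := congrArg (fun f => f (MvPolynomial.X j ⊗ₜ[K] F)) (wp_pow_tw (K := K) (n := n) k)
    simp only [Module.End.mul_apply, LinearMap.smul_apply] at h
    rw [show F ⊗ₜ[K] MvPolynomial.X j = tw (MvPolynomial.X j ⊗ₜ F) by simp]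
    simp only [moyalCoeff, LinearMap.smul_apply, LinearMap.comp_apply, h, map_smul, hm]
    rw [smul_comm]
  have e0 : moyalCoeff K n 0 (MvPolynomial.X j ⊗ₜ F) = MvPolynomial.X j * F := by
    simp [moyalCoeff]
  have e1 : moyalCoeff K n 1 (MvPolynomial.X j ⊗ₜ F) = (1 / 2 : K) • ham j F := by
    have := moyalCoeff_mx j ((1 : PolyAlg K n) ⊗ₜ[K] F) 0
    simp [moyalCoeff, wp_tmul] at this ⊢
    exact this
  have e2 : ∀ k, moyalCoeff K n (k + 2) (MvPolynomial.X j ⊗ₜ F) = 0 := fun k => by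
    have := moyalCoeff_mx j ((1 : PolyAlg K n) ⊗ₜ[K] F) (k + 1)
    have h0 : ∀ (k : ℕ) (G : PolyAlg K n), moyalCoeff K n (k + 1) ((1 : PolyAlg K n) ⊗ₜ[K] G) = 0 :=
      fun k G => by
        have := wp_pow_C_tmul (1 : K) G k
        rw [map_one] at this
        simp [moyalCoeff, this]
    simpa [h0] using this
  obtain ⟨N, hN⟩ := moyal_eq_sum (F ⊗ₜ[K] MvPolynomial.X j)
  rw [hN (N + 2) (by omega), Finset.sum_range_succ', Finset.sum_range_succ']
  rw [Finset.sum_eq_zero fun k _ => by rw [e, e2, smul_zero]]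
  simp [e, e0, e1, sub_eq_add_neg, add_comm]

theorem moyal_assoc (F G H : PolyAlg K n) :
    moyal K n (moyal K n (F ⊗ₜ G) ⊗ₜ H) = moyal K n (F ⊗ₜ moyal K n (G ⊗ₜ H)) := by
  -- multiplication by a coordinate on the left
  have hX : ∀ (j : Fin n ⊕ Fin n) (F G : PolyAlg K n),
      moyal K n (MvPolynomial.X j ⊗ₜ moyal K n (F ⊗ₜ G))
        = moyal K n (moyal K n (MvPolynomial.X j ⊗ₜ F) ⊗ₜ G) := by
    intro j F G
    have h1 := moyal_mx j (F ⊗ₜ[K] G)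
    have h2 := ham_moyal j (F ⊗ₜ[K] G)
    simp only [TensorProduct.map_tmul, LinearMap.mulLeft_apply, LinearMap.id_apply,
      Derivation.coeFn_coe] at h1 h2
    rw [moyal_X_tmul, moyal_X_tmul, TensorProduct.add_tmul, map_add, h1, h2,
      ← TensorProduct.smul_tmul', map_smul, smul_add]
    ring
  -- homogeneous polynomials, by strong induction on the degree
  have hd : ∀ (d : ℕ) (F : PolyAlg K n), F.IsHomogeneous d → ∀ G H : PolyAlg K n,
      moyal K n (moyal K n (F ⊗ₜ G) ⊗ₜ H) = moyal K n (F ⊗ₜ moyal K n (G ⊗ₜ H)) := by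
    intro d
    induction d using Nat.strong_induction_on with
    | _ d ih =>
    intro F hF G H
    rcases Nat.eq_zero_or_pos d with rfl | hpos
    · obtain ⟨a, rfl⟩ : ∃ a, F = MvPolynomial.C a :=
        ⟨_, MvPolynomial.totalDegree_eq_zero_iff_eq_C.mp
          (Nat.le_zero.mp hF.totalDegree_le)⟩
      rw [moyal_C_tmul, moyal_C_tmul, ← MvPolynomial.smul_eq_C_mul, ← MvPolynomial.smul_eq_C_mul,
        ← TensorProduct.smul_tmul', map_smul]
    · have hE : (d : K) • F = ∑ j, (moyal K n (MvPolynomial.X j ⊗ₜ MvPolynomial.pderiv j F)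
          - (1 / 2 : K) • ham j (MvPolynomial.pderiv j F)) := by
        rw [Nat.cast_smul_eq_nsmul, ← hF.sum_X_mul_pderiv]
        refine Finset.sum_congr rfl fun j _ => ?_
        rw [moyal_X_tmul, add_sub_cancel_right]
      have hd0 : (d : K) ≠ 0 := Nat.cast_ne_zero.mpr hpos.ne'
      have hF1 : ∀ j, (MvPolynomial.pderiv j F).IsHomogeneous (d - 1) := fun j => hF.pderiv
      have hF2 : ∀ j, (ham j (MvPolynomial.pderiv j F)).IsHomogeneous (d - 1 - 1) := by
        rintro (j | j)
        · exact (hF1 _).pderiv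
        · exact ((hF1 _).pderiv).neg
      have hF' : F = (d : K)⁻¹ • ((d : K) • F) := by rw [smul_smul, inv_mul_cancel₀ hd0, one_smul]
      rw [hF', hE]
      simp only [← TensorProduct.smul_tmul', TensorProduct.sum_tmul, TensorProduct.sub_tmul,
        map_smul, map_sum, map_sub]
      congr 1
      refine Finset.sum_congr rfl fun j _ => ?_
      congr 1
      · rw [← hX, ← hX, ← hX, ih (d - 1) (by omega) _ (hF1 j)]
      · congr 1
        exact ih (d - 1 - 1) (by omega) _ (hF2 j) G H
  rw [← MvPolynomial.sum_homogeneousComponent F]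
  simp only [TensorProduct.sum_tmul, map_sum]
  exact Finset.sum_congr rfl fun d _ =>
    hd d _ (MvPolynomial.homogeneousComponent_isHomogeneous d F) G H

/-! ### The Weyl algebra -/

variable (K n) in
/-- The Weyl algebra `W`, realized as the vector space `S` with the Moyal product as its
multiplication. -/
def Weyl : Type _ := PolyAlg K n

instance : AddCommGroup (Weyl K n) := inferInstanceAs (AddCommGroup (PolyAlg K n))

instance : Module K (Weyl K n) := inferInstanceAs (Module K (PolyAlg K n))

variable (K n) in
/-- The identification of the vector spaces `S` and `W`. -/
def toWeyl : PolyAlg K n ≃ₗ[K] Weyl K n := LinearEquiv.refl K (PolyAlg K n)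

/-- `F * G` in `W` is the Moyal product `F ⋆ G`. -/
instance : Mul (Weyl K n) :=
  ⟨fun F G => toWeyl K n (moyal K n ((toWeyl K n).symm F ⊗ₜ (toWeyl K n).symm G))⟩

instance : One (Weyl K n) := ⟨toWeyl K n 1⟩

theorem toWeyl_mul (F G : PolyAlg K n) :
    toWeyl K n F * toWeyl K n G = toWeyl K n (moyal K n (F ⊗ₜ G)) := rfl

instance : Ring (Weyl K n) where
  __ := (inferInstance : AddCommGroup (Weyl K n))
  mul_assoc F G H := congrArg (toWeyl K n) (moyal_assoc _ _ _)
  one_mul F := by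
    refine (congrArg (toWeyl K n) ?_ : _ = toWeyl K n ((toWeyl K n).symm F))
    exact (moyal_C_tmul (1 : K) _).trans (by rw [map_one, one_mul])
  mul_one F := by
    refine (congrArg (toWeyl K n) ?_ : _ = toWeyl K n ((toWeyl K n).symm F))
    exact (moyal_tmul_C _ (1 : K)).trans (by rw [map_one, mul_one])
  left_distrib F G H := by
    refine congrArg (toWeyl K n) ?_
    rw [map_add, TensorProduct.tmul_add, map_add]
    rfl
  right_distrib F G H := by
    refine congrArg (toWeyl K n) ?_
    rw [map_add, TensorProduct.add_tmul, map_add]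
    rfl
  zero_mul F := by
    refine (congrArg (toWeyl K n) ?_ : _ = toWeyl K n 0)
    rw [map_zero, TensorProduct.zero_tmul, map_zero]
  mul_zero F := by
    refine (congrArg (toWeyl K n) ?_ : _ = toWeyl K n 0)
    rw [map_zero, TensorProduct.tmul_zero, map_zero]

instance : Algebra K (Weyl K n) :=
  Algebra.ofModule
    (fun c F G => by
      refine (congrArg (toWeyl K n) ?_ :
        _ = toWeyl K n (c • moyal K n ((toWeyl K n).symm F ⊗ₜ (toWeyl K n).symm G)))
      rw [map_smul, ← TensorProduct.smul_tmul', map_smul])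
    (fun c F G => by
      refine (congrArg (toWeyl K n) ?_ :
        _ = toWeyl K n (c • moyal K n ((toWeyl K n).symm F ⊗ₜ (toWeyl K n).symm G)))
      rw [map_smul, TensorProduct.tmul_smul, map_smul])

variable (K n) in
/-- The coefficient `C_k : W × W → W` of the Moyal product, as a bilinear map. -/
def Ck (k : ℕ) : Weyl K n →ₗ[K] Weyl K n →ₗ[K] Weyl K n :=
  LinearMap.mk₂ K
    (fun F G => toWeyl K n (moyalCoeff K n k ((toWeyl K n).symm F ⊗ₜ (toWeyl K n).symm G)))
    (fun F F' G => by simp only [map_add, TensorProduct.add_tmul])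
    (fun c F G => by simp only [map_smul, ← TensorProduct.smul_tmul'])
    (fun F G G' => by simp only [map_add, TensorProduct.tmul_add])
    (fun c F G => by simp only [map_smul, TensorProduct.tmul_smul])

theorem Ck_apply (k : ℕ) (F G : PolyAlg K n) :
    Ck K n k (toWeyl K n F) (toWeyl K n G) = toWeyl K n (moyalCoeff K n k (F ⊗ₜ G)) := rfl

/-- Sanity check: `F ⋆ G = ∑ k, C_k (F, G)`. -/
theorem mul_eq_finsum_Ck (F G : Weyl K n) : F * G = ∑ᶠ k, Ck K n k F G := rfl

/-! ### The two brackets -/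

/-- `W` as a Lie algebra: `⁅F, G⁆ = F ⋆ G - G ⋆ F`. -/
instance : LieRing (Weyl K n) := LieRing.ofAssociativeRing

instance : LieAlgebra K (Weyl K n) := LieAlgebra.ofAssociativeAlgebra

theorem weyl_lie_def (F G : Weyl K n) : ⁅F, G⁆ = F * G - G * F := rfl

variable (K n) in
/-- The bracket `[F, G]_L = F ⋆ G - G ⋆ F` of the Lie algebra `W`, as a bilinear map. -/
def lieBracket : Weyl K n →ₗ[K] Weyl K n →ₗ[K] Weyl K n :=
  LinearMap.mul K (Weyl K n) - (LinearMap.mul K (Weyl K n)).flip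

theorem lieBracket_apply (F G : Weyl K n) : lieBracket K n F G = ⁅F, G⁆ := rfl

variable (K n) in
/-- The projection of `W = W₀ ⊕ W₁` on its component of parity `a`, the span of the monomials
whose degree has parity `a`. -/
def parityPart (a : ZMod 2) : Weyl K n →ₗ[K] Weyl K n :=
  (toWeyl K n).toLinearMap ∘ₗ
    MvPolynomial.weightedHomogeneousComponent (fun _ : Fin n ⊕ Fin n => (1 : ZMod 2)) a ∘ₗ
      (toWeyl K n).symm.toLinearMap

variable (K n) in
/-- The bracket of the Lie superalgebra `W`: the bilinear map such that
`[F, G] = F ⋆ G - (-1) ^ (a b) G ⋆ F` for `F` of parity `a` and `G` of parity `b`. -/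
def superBracket : Weyl K n →ₗ[K] Weyl K n →ₗ[K] Weyl K n :=
  ∑ a : ZMod 2, ∑ b : ZMod 2,
    ((LinearMap.mul K (Weyl K n)).compl₁₂ (parityPart K n a) (parityPart K n b)
      - (-1 : K) ^ (a.val * b.val) •
        (LinearMap.mul K (Weyl K n)).flip.compl₁₂ (parityPart K n a) (parityPart K n b))

variable (K n) in
/-- The subspace `S^ℓ` of `W` of homogeneous polynomials of degree `ℓ`. -/
def homog (l : ℕ) : Submodule K (Weyl K n) :=
  (MvPolynomial.homogeneousSubmodule (Fin n ⊕ Fin n) K l).map (toWeyl K n).toLinearMap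

theorem toWeyl_mem_homog {l : ℕ} {F : PolyAlg K n} :
    toWeyl K n F ∈ homog K n l ↔ F.IsHomogeneous l := by
  constructor
  · rintro ⟨G, hG, h⟩
    rw [← (toWeyl K n).injective h]
    exact hG
  · exact fun h => ⟨F, h, rfl⟩

theorem parityPart_of_mem {l : ℕ} {F : Weyl K n} (hF : F ∈ homog K n l) (a : ZMod 2) :
    parityPart K n a F = if a = (l : ZMod 2) then F else 0 := by
  obtain ⟨F, hF, rfl⟩ := hF
  have h : MvPolynomial.IsWeightedHomogeneous (fun _ : Fin n ⊕ Fin n => (1 : ZMod 2)) F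
      (l : ZMod 2) := by
    intro d hd
    have h1 := hF hd
    simp only [Finsupp.weight_apply, Finsupp.sum, smul_eq_mul, nsmul_eq_mul, mul_one,
      Pi.one_apply] at h1 ⊢
    rw [← h1]
    push_cast
    rfl
  split_ifs with e
  · subst e
    exact congrArg (toWeyl K n) h.weightedHomogeneousComponent_same
  · exact congrArg (toWeyl K n) (h.weightedHomogeneousComponent_ne a e)

/-- Sanity check: the super bracket on homogeneous polynomials. -/
theorem superBracket_of_mem {f g : ℕ} {F G : Weyl K n} (hF : F ∈ homog K n f)
    (hG : G ∈ homog K n g) :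
    superBracket K n F G = F * G - (-1 : K) ^ (f * g) • (G * F) := by
  simp only [superBracket, LinearMap.sum_apply, LinearMap.sub_apply, LinearMap.smul_apply,
    LinearMap.compl₁₂_apply, LinearMap.flip_apply, LinearMap.mul_apply',
    parityPart_of_mem hF, parityPart_of_mem hG]
  rw [Finset.sum_eq_single (f : ZMod 2), Finset.sum_eq_single (g : ZMod 2)]
  · have hp : (-1 : K) ^ ((f : ZMod 2).val * (g : ZMod 2).val) = (-1) ^ (f * g) := by
      rw [ZMod.val_natCast, ZMod.val_natCast, neg_one_pow_eq_pow_mod_two,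
        neg_one_pow_eq_pow_mod_two (n := f * g)]
      congr 1
      simp [Nat.mul_mod]
    rw [hp]
    simp
  · intro b _ hb; simp [hb]
  · simp
  · intro b _ hb; simp [hb]
  · simp

/-! ### The Lie algebra `S²` and its modules `S^ℓ` -/

variable (K n) in
/-- The coordinate `x_j`, as an element of `W`. -/
def coord (j : Fin n ⊕ Fin n) : Weyl K n := toWeyl K n (MvPolynomial.X j)

theorem coord_mul (j : Fin n ⊕ Fin n) (F : PolyAlg K n) :
    coord K n j * toWeyl K n F
      = toWeyl K n (MvPolynomial.X j * F + (1 / 2 : K) • ham j F) := by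
  rw [coord, toWeyl_mul, moyal_X_tmul]

theorem mul_coord (j : Fin n ⊕ Fin n) (F : PolyAlg K n) :
    toWeyl K n F * coord K n j
      = toWeyl K n (MvPolynomial.X j * F - (1 / 2 : K) • ham j F) := by
  rw [coord, toWeyl_mul, moyal_tmul_X]

theorem coord_lie (j : Fin n ⊕ Fin n) (F : PolyAlg K n) :
    ⁅coord K n j, toWeyl K n F⁆ = toWeyl K n (ham j F) := by
  rw [weyl_lie_def, coord_mul, mul_coord, ← map_sub]
  congr 1
  module

theorem ham_X (j i : Fin n ⊕ Fin n) :
    ham j (MvPolynomial.X i : PolyAlg K n) = MvPolynomial.C (- Matrix.J (Fin n) K j i) := by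
  rcases j with j | j <;> rcases i with i | i <;>
    simp [ham, Matrix.J, MvPolynomial.pderiv_X, Pi.single_apply, Matrix.one_apply, eq_comm]

theorem toWeyl_C (a : K) : toWeyl K n (MvPolynomial.C a) = a • (1 : Weyl K n) := by
  change _ = a • toWeyl K n 1
  rw [← map_smul, MvPolynomial.smul_eq_C_mul, mul_one]

theorem toWeyl_X_mul_X (i j : Fin n ⊕ Fin n) :
    toWeyl K n (MvPolynomial.X i * MvPolynomial.X j)
      = coord K n i * coord K n j - ((1 / 2 : K) * - Matrix.J (Fin n) K i j) • (1 : Weyl K n) := by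
  have h := coord_mul i (MvPolynomial.X j : PolyAlg K n)
  rw [ham_X, map_add, map_smul, toWeyl_C, smul_smul] at h
  exact eq_sub_of_add_eq h.symm

theorem X_mul_X_lie (i j : Fin n ⊕ Fin n) (F : PolyAlg K n) :
    ⁅toWeyl K n (MvPolynomial.X i * MvPolynomial.X j), toWeyl K n F⁆
      = toWeyl K n (MvPolynomial.X i * ham j F + MvPolynomial.X j * ham i F) := by
  have h : ⁅toWeyl K n (MvPolynomial.X i * MvPolynomial.X j), toWeyl K n F⁆
      = coord K n i * ⁅coord K n j, toWeyl K n F⁆ + ⁅coord K n i, toWeyl K n F⁆ * coord K n j := by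
    rw [toWeyl_X_mul_X]
    simp only [weyl_lie_def, sub_mul, mul_sub, smul_mul_assoc, mul_smul_comm, one_mul, mul_one,
      mul_assoc]
    abel
  rw [h, coord_lie, coord_lie, coord_mul, mul_coord, ← map_add, ham_comm j i]
  congr 1
  abel

theorem exists_C_of_homogeneous_zero {F : PolyAlg K n} (hF : F.IsHomogeneous 0) :
    ∃ a, F = MvPolynomial.C a :=
  ⟨_, MvPolynomial.totalDegree_eq_zero_iff_eq_C.mp (Nat.le_zero.mp hF.totalDegree_le)⟩

theorem exists_eq_sum_of_homogeneous_one {F : PolyAlg K n} (hF : F.IsHomogeneous 1) :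
    ∃ a : Fin n ⊕ Fin n → K, F = ∑ i, a i • MvPolynomial.X i := by
  have h := hF.sum_X_mul_pderiv
  choose a ha using fun i => exists_C_of_homogeneous_zero (hF.pderiv (i := i))
  refine ⟨a, ?_⟩
  rw [one_smul] at h
  conv_lhs => rw [← h]
  refine Finset.sum_congr rfl fun i _ => ?_
  rw [ha i, MvPolynomial.smul_eq_C_mul, mul_comm]

theorem exists_eq_sum_of_homogeneous_two {F : PolyAlg K n} (hF : F.IsHomogeneous 2) :
    ∃ a : Fin n ⊕ Fin n → Fin n ⊕ Fin n → K,
      F = ∑ i, ∑ j, a i j • (MvPolynomial.X i * MvPolynomial.X j) := by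
  have h := hF.sum_X_mul_pderiv
  choose a ha using fun i => exists_eq_sum_of_homogeneous_one (hF.pderiv (i := i))
  refine ⟨fun i j => (1 / 2 : K) * a i j, ?_⟩
  have h2 : F = (1 / 2 : K) • (2 • F) := by
    rw [← Nat.cast_smul_eq_nsmul K, smul_smul]
    norm_num
  rw [h2, ← h, Finset.smul_sum]
  refine Finset.sum_congr rfl fun i _ => ?_
  rw [ha i, Finset.mul_sum, Finset.smul_sum]
  refine Finset.sum_congr rfl fun j _ => ?_
  rw [mul_smul_comm, smul_smul]

theorem ham_isHomogeneous {l : ℕ} {F : PolyAlg K n} (hF : F.IsHomogeneous (l + 1))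
    (j : Fin n ⊕ Fin n) : (ham j F).IsHomogeneous l := by
  rcases j with j | j
  · exact hF.pderiv
  · exact (hF.pderiv (i := Sum.inl j)).neg

theorem homog_two_lie_mem {l : ℕ} {X F : Weyl K n} (hX : X ∈ homog K n 2)
    (hF : F ∈ homog K n l) : ⁅X, F⁆ ∈ homog K n l := by
  obtain ⟨X, hX, rfl⟩ := hX
  obtain ⟨F, hF, rfl⟩ := hF
  obtain ⟨a, rfl⟩ := exists_eq_sum_of_homogeneous_two hX
  simp only [LinearEquiv.coe_coe, map_sum, map_smul, sum_lie, smul_lie, X_mul_X_lie]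
  refine Submodule.sum_mem _ fun i _ => Submodule.sum_mem _ fun j _ => Submodule.smul_mem _ _ ?_
  rw [toWeyl_mem_homog]
  rcases l with _ | l
  · obtain ⟨c, rfl⟩ := exists_C_of_homogeneous_zero hF
    have : ∀ j, ham j (MvPolynomial.C c : PolyAlg K n) = 0 := by
      rintro (j | j) <;> simp [ham]
    simpa [this] using MvPolynomial.isHomogeneous_zero _ _ 0
  · rw [add_comm l 1]
    exact ((MvPolynomial.isHomogeneous_X _ _).mul (ham_isHomogeneous hF _)).add
      ((MvPolynomial.isHomogeneous_X _ _).mul (ham_isHomogeneous hF _))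

variable (K n) in
/-- The even part `𝔤₀ = sp(2n)` of `osp(1, 2n)`, realized as the Lie subalgebra `S²` of the Lie
algebra `W`; see `g0EquivSp` for the identification with `sp(2n)`. -/
def g0 : LieSubalgebra K (Weyl K n) where
  __ := homog K n 2
  lie_mem' := fun hX hY => homog_two_lie_mem hX hY

variable (K n) in
/-- `S^ℓ`, as a module over `𝔤₀ = S²` for the adjoint action `X · F = ad X (F) = [X, F]_L`. -/
def S (l : ℕ) : LieSubmodule K (g0 K n) (Weyl K n) where
  __ := homog K n l
  lie_mem := fun {X _} hF => homog_two_lie_mem X.2 hF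

/-- Sanity check: on `𝔤₀` the adjoint actions of the Lie algebra `W` and of the Lie superalgebra
`W` coincide. -/
theorem superBracket_g0 (X : g0 K n) (F : Weyl K n) :
    superBracket K n (X : Weyl K n) F = ⁅X, F⁆ := by
  obtain ⟨F, rfl⟩ := (toWeyl K n).surjective F
  rw [← MvPolynomial.sum_homogeneousComponent F, map_sum, map_sum, lie_sum]
  refine Finset.sum_congr rfl fun d _ => ?_
  rw [superBracket_of_mem (f := 2) (g := d) X.2
    (toWeyl_mem_homog.mpr (MvPolynomial.homogeneousComponent_isHomogeneous d F)), pow_mul]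
  simp [LieSubalgebra.coe_bracket_of_module, weyl_lie_def]

/-! ### The identification of `S²` with `sp(2n)` -/

variable (K n) in
/-- The coefficient of the coordinate `x_i`. -/
def linCoeff (i : Fin n ⊕ Fin n) : Weyl K n →ₗ[K] K :=
  MvPolynomial.lcoeff K (Finsupp.single i 1) ∘ₗ (toWeyl K n).symm.toLinearMap

theorem linCoeff_coord (i j : Fin n ⊕ Fin n) :
    linCoeff K n i (coord K n j) = if j = i then 1 else 0 := by
  change MvPolynomial.coeff (Finsupp.single i 1) (MvPolynomial.X j : PolyAlg K n) = _
  rw [MvPolynomial.coeff_X]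
  simp only [Finsupp.single_left_inj one_ne_zero]

theorem linCoeff_sum (i : Fin n ⊕ Fin n) (a : Fin n ⊕ Fin n → K) :
    linCoeff K n i (∑ k, a k • coord K n k) = a i := by
  simp only [map_sum, map_smul, linCoeff_coord, smul_eq_mul, mul_ite, mul_one, mul_zero,
    Finset.sum_ite_eq', Finset.mem_univ, if_true]

/-- The matrix of `ad X` on `S¹`, in the basis of coordinates: the entry `(i, j)` is the
coefficient of `x_i` in `[X, x_j]_L`. -/
def adMatrix : g0 K n →ₗ[K] Matrix (Fin n ⊕ Fin n) (Fin n ⊕ Fin n) K where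
  toFun X := Matrix.of fun i j => linCoeff K n i ⁅(X : Weyl K n), coord K n j⁆
  map_add' X Y := by
    ext i j
    simp [add_lie]
  map_smul' c X := by
    ext i j
    simp [smul_lie]

theorem lie_coord (X : g0 K n) (j : Fin n ⊕ Fin n) :
    ⁅(X : Weyl K n), coord K n j⁆ = ∑ i, adMatrix X i j • coord K n i := by
  have hmem : ⁅(X : Weyl K n), coord K n j⁆ ∈ homog K n 1 :=
    homog_two_lie_mem X.2 (toWeyl_mem_homog.mpr (MvPolynomial.isHomogeneous_X K j))
  obtain ⟨F, hF, h⟩ := hmem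
  obtain ⟨a, rfl⟩ := exists_eq_sum_of_homogeneous_one hF
  have h' : ⁅(X : Weyl K n), coord K n j⁆ = ∑ i, a i • coord K n i := by
    rw [← h]
    simp [coord]
  have ha : ∀ i, adMatrix X i j = a i := fun i => by
    change linCoeff K n i ⁅(X : Weyl K n), coord K n j⁆ = a i
    rw [h', linCoeff_sum]
  simp only [ha, h']

theorem lie_coord_coord (i j : Fin n ⊕ Fin n) :
    ⁅coord K n i, coord K n j⁆ = (- Matrix.J (Fin n) K i j) • (1 : Weyl K n) := by
  rw [← toWeyl_C, ← ham_X, ← coord_lie]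
  rfl

theorem adMatrix_mem_sp (X : g0 K n) : adMatrix X ∈ LieAlgebra.Symplectic.sp (Fin n) K := by
  rw [LieAlgebra.Symplectic.sp, mem_skewAdjointMatricesLieSubalgebra,
    mem_skewAdjointMatricesSubmodule, Matrix.IsSkewAdjoint, Matrix.IsAdjointPair]
  ext i j
  have h1 : ∀ c : K, c • (1 : Weyl K n) = 0 → c = 0 := by
    intro c hc
    rw [← toWeyl_C, LinearEquiv.map_eq_zero_iff, MvPolynomial.C_eq_zero] at hc
    exact hc
  have h := leibniz_lie (X : Weyl K n) (coord K n i) (coord K n j)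
  rw [lie_coord_coord, lie_coord, lie_coord] at h
  simp only [sum_lie, lie_sum, smul_lie, lie_smul, lie_coord_coord, smul_smul,
    ← Finset.sum_smul, ← add_smul] at h
  have h0 : ⁅(X : Weyl K n), (1 : Weyl K n)⁆ = 0 := by simp [weyl_lie_def]
  rw [h0, smul_zero] at h
  have h2 := h1 _ h.symm
  simp only [Matrix.mul_apply, Matrix.transpose_apply, Matrix.neg_apply, mul_neg,
    Finset.sum_neg_distrib] at h2 ⊢
  rw [← sub_eq_zero, ← neg_eq_zero]
  rw [← h2]
  simp only [mul_comm (adMatrix X _ j)]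
  ring

variable (K n) in
/-- The map `X ↦ ad X` restricted to `S¹`, as a morphism of Lie algebras from `S²` to `sp(2n)`. -/
def g0ToSp : g0 K n →ₗ⁅K⁆ LieAlgebra.Symplectic.sp (Fin n) K where
  toFun X := ⟨adMatrix X, adMatrix_mem_sp X⟩
  map_add' X Y := Subtype.ext (map_add adMatrix X Y)
  map_smul' c X := Subtype.ext (map_smul adMatrix c X)
  map_lie' := by
    intro X Y
    apply Subtype.ext
    change adMatrix ⁅X, Y⁆ = adMatrix X * adMatrix Y - adMatrix Y * adMatrix X
    ext i j
    change linCoeff K n i ⁅⁅(X : Weyl K n), (Y : Weyl K n)⁆, coord K n j⁆ = _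
    rw [lie_lie, lie_coord, lie_coord]
    simp only [lie_sum, lie_smul, map_sub, map_sum, map_smul]
    simp only [lie_coord, linCoeff_sum, Matrix.sub_apply, Matrix.mul_apply, smul_eq_mul, mul_comm]

theorem g0ToSp_injective : Function.Injective (g0ToSp K n) := by
  rw [injective_iff_map_eq_zero]
  intro X hX
  have hM : adMatrix X = 0 := by
    change (g0ToSp K n X).1 = 0
    rw [hX]
    rfl
  obtain ⟨F, hF, hFX⟩ := X.2
  have hh : ∀ j, ham j F = 0 := fun j => by
    have h := lie_coord X j
    simp only [hM, Matrix.zero_apply, zero_smul, Finset.sum_const_zero] at h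
    rw [← lie_skew, neg_eq_zero, ← hFX] at h
    change ⁅coord K n j, toWeyl K n F⁆ = 0 at h
    rwa [coord_lie, LinearEquiv.map_eq_zero_iff] at h
  have hp : ∀ j, MvPolynomial.pderiv j F = 0 := by
    rintro (j | j)
    · have := hh (Sum.inr j)
      change - MvPolynomial.pderiv (Sum.inl j) F = 0 at this
      rwa [neg_eq_zero] at this
    · exact hh (Sum.inl j)
  have hE := hF.sum_X_mul_pderiv
  simp only [hp, mul_zero, Finset.sum_const_zero] at hE
  have hF0 : F = 0 := by
    rcases smul_eq_zero.mp hE.symm with h | h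
    · norm_num at h
    · exact h
  apply Subtype.ext
  rw [← hFX, hF0, map_zero]
  rfl

theorem g0ToSp_surjective : Function.Surjective (g0ToSp K n) := by
  rintro ⟨A, hA⟩
  rw [LieAlgebra.Symplectic.sp, mem_skewAdjointMatricesLieSubalgebra,
    mem_skewAdjointMatricesSubmodule, Matrix.IsSkewAdjoint, Matrix.IsAdjointPair] at hA
  set J := Matrix.J (Fin n) K with hJ
  have hJ2 : J * J = -1 := Matrix.J_squared _ _
  have hJt : J.transpose = -J := Matrix.J_transpose _ _
  let N : Matrix (Fin n ⊕ Fin n) (Fin n ⊕ Fin n) K := -(J * A.transpose)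
  have hN : N.transpose = N := by
    have h1 : J * (A.transpose * J) * J = J * (J * -A) * J := by rw [hA]
    have h2 : J * A.transpose * (J * J) = (J * J) * -A * J := by simpa only [Matrix.mul_assoc] using h1
    rw [hJ2] at h2
    simp only [Matrix.mul_neg, Matrix.neg_mul, Matrix.mul_one, Matrix.one_mul, neg_neg] at h2
    simp only [N, Matrix.transpose_neg, Matrix.transpose_mul, Matrix.transpose_transpose, hJt,
      Matrix.mul_neg, neg_neg]
    exact h2.symm
  have hJN : J * N = A.transpose := by
    simp only [N, Matrix.mul_neg, ← Matrix.mul_assoc, hJ2, Matrix.neg_mul, neg_neg, Matrix.one_mul]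
  let F : PolyAlg K n :=
    (1 / 2 : K) • ∑ k, ∑ l, N k l • (MvPolynomial.X k * MvPolynomial.X l)
  have hF : F.IsHomogeneous 2 := by
    have : F ∈ MvPolynomial.homogeneousSubmodule (Fin n ⊕ Fin n) K 2 :=
      Submodule.smul_mem _ _ (Submodule.sum_mem _ fun k _ => Submodule.sum_mem _ fun l _ =>
        Submodule.smul_mem _ _
          ((MvPolynomial.isHomogeneous_X K k).mul (MvPolynomial.isHomogeneous_X K l)))
    exact this
  refine ⟨⟨toWeyl K n F, toWeyl_mem_homog.mpr hF⟩, ?_⟩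
  apply Subtype.ext
  ext i j
  change linCoeff K n i ⁅toWeyl K n F, coord K n j⁆ = A i j
  have e : ⁅toWeyl K n F, coord K n j⁆ = ∑ l, A l j • coord K n l := by
    have e1 : ∀ k l, ⁅toWeyl K n (MvPolynomial.X k * MvPolynomial.X l), coord K n j⁆
        = J j l • coord K n k + J j k • coord K n l := by
      intro k l
      have hs : ∀ a b, J a b = - J b a := fun a b => congrFun (congrFun hJt b) a
      rw [coord, X_mul_X_lie, ham_X, ham_X, mul_comm, mul_comm (MvPolynomial.X l),
        ← MvPolynomial.smul_eq_C_mul, ← MvPolynomial.smul_eq_C_mul, map_add, map_smul, map_smul,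
        ← hJ, ← hs, ← hs]
      rfl
    have e2 : ⁅toWeyl K n F, coord K n j⁆ = (1 / 2 : K) •
        (∑ k, (J * N.transpose) j k • coord K n k + ∑ l, (J * N) j l • coord K n l) := by
      simp only [F, map_smul, map_sum, smul_lie, sum_lie, e1, smul_add, Finset.sum_add_distrib,
        Matrix.mul_apply, Finset.sum_smul, Matrix.transpose_apply, smul_smul]
      rw [Finset.sum_comm (f := fun k l => (N k l * J j k) • coord K n l)]
      simp only [mul_comm (J j _)]
    rw [e2, hN, hJN, ← two_smul K, smul_smul]
    norm_num
  rw [e, linCoeff_sum]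

variable (K n) in
/-- The identification of the Lie algebra `S²` with the symplectic Lie algebra `sp(2n)`, given by
the adjoint action of `S²` on `S¹`. -/
def g0EquivSp : g0 K n ≃ₗ⁅K⁆ LieAlgebra.Symplectic.sp (Fin n) K :=
  LieEquiv.ofBijective (g0ToSp K n) ⟨g0ToSp_injective, g0ToSp_surjective⟩

/-! ### Images and direct sums -/

/-- `N` is the internal direct sum of the family of subspaces `V i`. -/
def IsInternalSum {ι : Type*} (N : Submodule K (Weyl K n)) (V : ι → Submodule K (Weyl K n)) :
    Prop :=
  iSupIndep V ∧ N = ⨆ i, V i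

/-- For a bilinear map `β` on `W`, the subspace `β(S^ℓ, S^m)`, spanned by the `β(F, G)` with
`F ∈ S^ℓ` and `G ∈ S^m`. -/
def imageHomog (β : Weyl K n →ₗ[K] Weyl K n →ₗ[K] Weyl K n) (l m : ℕ) : Submodule K (Weyl K n) :=
  Submodule.map₂ β (homog K n l) (homog K n m)

end MoyalWeyl

end

/-!
Homogeneous polynomials `F ∈ S^ℓ`, `G ∈ S^m` satisfy `C_k (F, G) ∈ S^(ℓ+m-2k)` for
`k ≤ min ℓ m` and `C_k (F, G) = 0` for larger `k` (`moyalCoeff_isHomogeneous`,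
`moyalCoeff_eq_zero`), and `C_k` is symmetric or antisymmetric according to the parity of `k`
(`moyalCoeff_swap`). Hence each of the bilinear maps under study agrees on `S^ℓ × S^m` with a finite
combination `β = ∑ ε_k C_k`, `k ≤ min ℓ m`, where `ε_k` is `1`, `1 - (-1)^k`,
`1 - (-1)^(ℓm+k)` or a Kronecker delta, and all the claims follow from one:
`β (S^ℓ, S^m)` is the direct sum of the `S^(ℓ+m-2k)` with `k ≤ min ℓ m` and `ε_k ≠ 0`
(`imageHomog_eq_iSup`, `homog_iSupIndep`).

* Equivariance (`lie_Ck`). An element `X` of `S²` acts on `W` by a derivation of `⋆` that preserves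
  the degree. The Leibniz rule for `F ⋆ G = ∑ C_k (F, G)` holds in each degree separately, and the
  terms of the sum have distinct degrees.
* Cyclicity (`homog_le_of_pow_mem`). Write `p = p₁`, `q = q₁`. A `𝔤₀`-submodule of `W` that
  contains `p^r` contains `S^r`: the action of `x_i q` replaces a factor `p` by a nonzero multiple
  of `x_i`, up to terms with a higher power of `p`.
* Surjectivity (`homog_le_of_Ck_sum_mem`). In `β (p^ℓ, p^(m-k) q^k)` the terms `C_j` with `j > k`
  vanish, and `C_k` is a nonzero multiple of `p^(ℓ+m-2k)`. By induction on `k` the terms with `j < k`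
  already lie in the image, so the image contains `p^(ℓ+m-2k)` as soon as `ε_k ≠ 0`, and then all
  of `S^(ℓ+m-2k)`. In particular no comparison of simple `𝔤₀`-modules is needed.
-/

open scoped TensorProduct

noncomputable section

namespace MoyalWeyl

variable {K : Type*} [Field K] {n : ℕ}

/-! ### Degrees and symmetry of the coefficients -/

theorem moyalCoeff_zero (F G : PolyAlg K n) : moyalCoeff K n 0 (F ⊗ₜ G) = F * G := by
  simp [moyalCoeff]

theorem moyalCoeff_swap (k : ℕ) (F G : PolyAlg K n) :
    moyalCoeff K n k (G ⊗ₜ F) = (-1 : K) ^ k • moyalCoeff K n k (F ⊗ₜ G) := by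
  have hm : ∀ w : PolyAlg K n ⊗[K] PolyAlg K n,
      LinearMap.mul' K (PolyAlg K n) (tw w) = LinearMap.mul' K (PolyAlg K n) w := by
    intro w
    induction w with
    | zero => simp
    | add x y hx hy => rw [map_add, map_add, map_add, hx, hy]
    | tmul F G => simp [mul_comm]
  have h := congrArg (fun f => f (F ⊗ₜ[K] G)) (wp_pow_tw (K := K) (n := n) k)
  simp only [Module.End.mul_apply, LinearMap.smul_apply] at h
  rw [show G ⊗ₜ[K] F = tw (F ⊗ₜ G) by simp]
  simp only [moyalCoeff, LinearMap.smul_apply, LinearMap.comp_apply, h, map_smul, hm]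
  rw [smul_comm]

theorem wp_pow_pow_tmul (i : Fin n) (a b c k : ℕ) :
    (wp K n ^ k) ((MvPolynomial.X (Sum.inl i) ^ a) ⊗ₜ
        (MvPolynomial.X (Sum.inl i) ^ b * MvPolynomial.X (Sum.inr i) ^ c))
      = ((a.descFactorial k * c.descFactorial k : ℕ) : K) •
        ((MvPolynomial.X (Sum.inl i) ^ (a - k)) ⊗ₜ
          (MvPolynomial.X (Sum.inl i) ^ b * MvPolynomial.X (Sum.inr i) ^ (c - k))) := by
  classical
  induction k with
  | zero => simp
  | succ k ih =>
    rw [pow_succ', Module.End.mul_apply, ih, map_smul, wp_tmul, Finset.sum_eq_single i]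
    · have h1 : MvPolynomial.pderiv (Sum.inl i)
          ((MvPolynomial.X (Sum.inl i) : PolyAlg K n) ^ (a - k))
          = ((a - k : ℕ) : K) • MvPolynomial.X (Sum.inl i) ^ (a - (k + 1)) := by
        rw [Derivation.leibniz_pow, MvPolynomial.pderiv_X_self, Nat.cast_smul_eq_nsmul,
          smul_eq_mul, mul_one, Nat.sub_sub]
      have h2 : MvPolynomial.pderiv (Sum.inr i)
          ((MvPolynomial.X (Sum.inl i) : PolyAlg K n) ^ b * MvPolynomial.X (Sum.inr i) ^ (c - k))
          = ((c - k : ℕ) : K) •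
            (MvPolynomial.X (Sum.inl i) ^ b * MvPolynomial.X (Sum.inr i) ^ (c - (k + 1))) := by
        rw [Derivation.leibniz, Derivation.leibniz_pow, Derivation.leibniz_pow,
          MvPolynomial.pderiv_X_self, MvPolynomial.pderiv_X_of_ne (by simp), Nat.cast_smul_eq_nsmul,
          Nat.sub_sub]
        simp
        ring
      have h3 : MvPolynomial.pderiv (Sum.inr i)
          ((MvPolynomial.X (Sum.inl i) : PolyAlg K n) ^ (a - k)) = 0 := by
        rw [Derivation.leibniz_pow, MvPolynomial.pderiv_X_of_ne (by simp)]
        simp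
      rw [h1, h2, h3, TensorProduct.zero_tmul, sub_zero, TensorProduct.smul_tmul_smul, smul_smul,
        Nat.descFactorial_succ, Nat.descFactorial_succ]
      push_cast
      congr 1
      ring
    · intro j _ hj
      rw [Derivation.leibniz_pow, Derivation.leibniz_pow,
        MvPolynomial.pderiv_X_of_ne (by simpa using hj.symm),
        MvPolynomial.pderiv_X_of_ne (by simp)]
      simp
    · simp

variable [CharZero K]

/-- Euler's identity, solved for the polynomial. -/
theorem eq_smul_sum_X_mul_pderiv {d : ℕ} {F : PolyAlg K n} (hF : F.IsHomogeneous (d + 1)) :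
    F = ((d + 1 : ℕ) : K)⁻¹ • ∑ j, MvPolynomial.X j * MvPolynomial.pderiv j F := by
  rw [hF.sum_X_mul_pderiv, ← Nat.cast_smul_eq_nsmul K, smul_smul,
    inv_mul_cancel₀ (Nat.cast_ne_zero.mpr d.succ_ne_zero), one_smul]

/-- Induction on the degree for homogeneous polynomials in characteristic zero. -/
theorem isHomogeneous_induction {P : ℕ → PolyAlg K n → Prop}
    (C : ∀ a, P 0 (MvPolynomial.C a))
    (sum : ∀ (d : ℕ) (f : Fin n ⊕ Fin n → PolyAlg K n), (∀ j, P d (f j)) → P d (∑ j, f j))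
    (smul : ∀ (d : ℕ) (c : K) (F : PolyAlg K n), P d F → P d (c • F))
    (X_mul : ∀ (d : ℕ) (j : Fin n ⊕ Fin n) (F : PolyAlg K n), F.IsHomogeneous d → P d F →
      P (d + 1) (MvPolynomial.X j * F))
    {d : ℕ} {F : PolyAlg K n} (hF : F.IsHomogeneous d) : P d F := by
  induction d generalizing F with
  | zero =>
    obtain ⟨a, rfl⟩ := exists_C_of_homogeneous_zero hF
    exact C a
  | succ d ih =>
    rw [eq_smul_sum_X_mul_pderiv hF]
    exact smul _ _ _ (sum _ _ fun j => X_mul d j _ hF.pderiv (ih hF.pderiv))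

theorem moyalCoeff_succ_X_mul_tmul (k : ℕ) (j : Fin n ⊕ Fin n) (F G : PolyAlg K n) :
    moyalCoeff K n (k + 1) ((MvPolynomial.X j * F) ⊗ₜ G)
      = MvPolynomial.X j * moyalCoeff K n (k + 1) (F ⊗ₜ G)
        + (1 / 2 : K) • moyalCoeff K n k (F ⊗ₜ ham j G) := by
  simpa using moyalCoeff_mx j (F ⊗ₜ[K] G) k

theorem moyalCoeff_eq_zero_of_left_lt {l k : ℕ} {F : PolyAlg K n} (hF : F.IsHomogeneous l)
    (hk : l < k) (G : PolyAlg K n) : moyalCoeff K n k (F ⊗ₜ G) = 0 := by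
  refine isHomogeneous_induction
    (P := fun d F => ∀ k G, d < k → moyalCoeff K n k (F ⊗ₜ G) = 0) ?_ ?_ ?_ ?_ hF k G hk
  · intro a k G hk
    obtain ⟨k, rfl⟩ := Nat.exists_eq_add_of_le' hk
    simp [moyalCoeff, wp_pow_C_tmul]
  · intro d f hf k G hk
    rw [TensorProduct.sum_tmul, map_sum]
    exact Finset.sum_eq_zero fun j _ => hf j k G hk
  · intro d c F hF k G hk
    rw [← TensorProduct.smul_tmul', map_smul, hF k G hk, smul_zero]
  · intro d j F _ ih k G hk
    obtain ⟨k, rfl⟩ := Nat.exists_eq_add_of_le' (Nat.one_le_of_lt hk)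
    rw [moyalCoeff_succ_X_mul_tmul, ih _ _ (by omega), ih _ _ (by omega)]
    simp

theorem moyalCoeff_eq_zero {l m k : ℕ} {F G : PolyAlg K n} (hF : F.IsHomogeneous l)
    (hG : G.IsHomogeneous m) (hk : min l m < k) : moyalCoeff K n k (F ⊗ₜ G) = 0 := by
  rcases min_lt_iff.mp hk with h | h
  · exact moyalCoeff_eq_zero_of_left_lt hF h G
  · rw [moyalCoeff_swap, moyalCoeff_eq_zero_of_left_lt hG h, smul_zero]

theorem moyalCoeff_isHomogeneous {l m k : ℕ} {F G : PolyAlg K n} (hF : F.IsHomogeneous l)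
    (hG : G.IsHomogeneous m) (hk : k ≤ min l m) :
    (moyalCoeff K n k (F ⊗ₜ G)).IsHomogeneous (l + m - 2 * k) := by
  refine isHomogeneous_induction
    (P := fun d F => ∀ m k G, MvPolynomial.IsHomogeneous G m → k ≤ min d m →
      (moyalCoeff K n k (F ⊗ₜ G)).IsHomogeneous (d + m - 2 * k)) ?_ ?_ ?_ ?_ hF m k G hG hk
  · intro a m k G hG hk
    obtain rfl : k = 0 := by omega
    rw [moyalCoeff_zero]
    exact (MvPolynomial.isHomogeneous_C _ a).mul hG
  · intro d f hf m k G hG hk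
    rw [TensorProduct.sum_tmul, map_sum]
    exact MvPolynomial.IsHomogeneous.sum _ _ _ fun j _ => hf j m k G hG hk
  · intro d c F hF m k G hG hk
    rw [← TensorProduct.smul_tmul', map_smul]
    exact Submodule.smul_mem (MvPolynomial.homogeneousSubmodule _ K _) c (hF m k G hG hk)
  · intro d j F hF ih m k G hG hk
    obtain _ | k := k
    · rw [moyalCoeff_zero, add_comm d 1]
      exact ((MvPolynomial.isHomogeneous_X K j).mul hF).mul hG
    · obtain _ | m := m
      · omega
      rw [moyalCoeff_succ_X_mul_tmul]
      refine MvPolynomial.IsHomogeneous.add ?_ ?_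
      · by_cases h : k + 1 ≤ min d (m + 1)
        · have := (MvPolynomial.isHomogeneous_X K j).mul (ih _ _ G hG h)
          rwa [show 1 + (d + (m + 1) - 2 * (k + 1)) = d + 1 + (m + 1) - 2 * (k + 1) by omega]
            at this
        · rw [moyalCoeff_eq_zero hF hG (not_le.mp h), mul_zero]
          exact MvPolynomial.isHomogeneous_zero _ _ _
      · have := ih m k _ (ham_isHomogeneous hG j) (by omega)
        rw [show d + m - 2 * k = d + 1 + (m + 1) - 2 * (k + 1) by omega] at this
        exact Submodule.smul_mem (MvPolynomial.homogeneousSubmodule _ K _) _ this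

theorem Ck_mem_homog {l m k : ℕ} {F G : Weyl K n} (hF : F ∈ homog K n l) (hG : G ∈ homog K n m)
    (hk : k ≤ min l m) : Ck K n k F G ∈ homog K n (l + m - 2 * k) := by
  obtain ⟨F, hF, rfl⟩ := hF
  obtain ⟨G, hG, rfl⟩ := hG
  exact toWeyl_mem_homog.mpr (moyalCoeff_isHomogeneous hF hG hk)

theorem Ck_eq_zero {l m k : ℕ} {F G : Weyl K n} (hF : F ∈ homog K n l) (hG : G ∈ homog K n m)
    (hk : min l m < k) : Ck K n k F G = 0 := by
  obtain ⟨F, hF, rfl⟩ := hF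
  obtain ⟨G, hG, rfl⟩ := hG
  exact congrArg (toWeyl K n) (moyalCoeff_eq_zero hF hG hk)

theorem Ck_swap (k : ℕ) (F G : Weyl K n) : Ck K n k G F = (-1 : K) ^ k • Ck K n k F G :=
  congrArg (toWeyl K n) (moyalCoeff_swap k _ _)

theorem mul_eq_sum_Ck {l m : ℕ} {F G : Weyl K n} (hF : F ∈ homog K n l)
    (hG : G ∈ homog K n m) :
    F * G = ∑ k ∈ Finset.range (min l m + 1), Ck K n k F G := by
  rw [mul_eq_finsum_Ck]
  refine finsum_eq_sum_of_support_subset _ fun k hk => ?_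
  simp only [Finset.coe_range, Set.mem_Iio]
  by_contra h
  exact hk (Ck_eq_zero hF hG (by omega))

theorem mul_swap_eq_sum_Ck {l m : ℕ} {F G : Weyl K n} (hF : F ∈ homog K n l)
    (hG : G ∈ homog K n m) :
    G * F = ∑ k ∈ Finset.range (min l m + 1), (-1 : K) ^ k • Ck K n k F G := by
  rw [mul_eq_sum_Ck hG hF, min_comm]
  exact Finset.sum_congr rfl fun k _ => Ck_swap k F G

/-! ### The degree decomposition and equivariance -/

theorem homog_iSupIndep : iSupIndep (homog K n) := by
  have h : iSupIndep (MvPolynomial.homogeneousSubmodule (Fin n ⊕ Fin n) K) :=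
    letI := MvPolynomial.gradedAlgebra (σ := Fin n ⊕ Fin n) (R := K)
    (DirectSum.Decomposition.isInternal _).submodule_iSupIndep
  exact h.map_orderIso (Submodule.orderIsoMapComap (toWeyl K n))

/-- Elements of distinct degrees with sum zero are zero. -/
theorem eq_zero_of_sum_eq_zero {s : Finset ℕ} {e : ℕ → ℕ} (he : Set.InjOn e s)
    {v : ℕ → Weyl K n} (hv : ∀ k ∈ s, v k ∈ homog K n (e k)) (h : ∑ k ∈ s, v k = 0) :
    ∀ k ∈ s, v k = 0 := by
  have hc : ∀ d, ∀ k ∈ s, MvPolynomial.homogeneousComponent d ((toWeyl K n).symm (v k))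
      = if e k = d then (toWeyl K n).symm (v k) else 0 := by
    intro d k hk
    obtain ⟨F, hF, hFv⟩ := hv k hk
    rw [← hFv]
    simpa [eq_comm] using MvPolynomial.homogeneousComponent_of_mem (m := d) hF
  intro k hk
  have h' := congrArg (fun w => MvPolynomial.homogeneousComponent (e k) ((toWeyl K n).symm w)) h
  simp only [map_sum, map_zero] at h'
  rw [Finset.sum_congr rfl (hc (e k)), Finset.sum_eq_single k, if_pos rfl] at h'
  · exact (LinearEquiv.map_eq_zero_iff _).mp h'
  · exact fun j hj hjk => if_neg fun hjk' => hjk (he hj hk hjk')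
  · exact fun h => (h hk).elim

/-- The coefficients `C_k` are equivariant: compare the terms of degree `l + m - 2 * k` in the
Leibniz rule for the Moyal product. -/
theorem lie_Ck {l m : ℕ} {X F G : Weyl K n} (hX : X ∈ homog K n 2) (hF : F ∈ homog K n l)
    (hG : G ∈ homog K n m) (k : ℕ) :
    ⁅X, Ck K n k F G⁆ = Ck K n k ⁅X, F⁆ G + Ck K n k F ⁅X, G⁆ := by
  have hXF := homog_two_lie_mem hX hF
  have hXG := homog_two_lie_mem hX hG
  by_cases hk : k ≤ min l m
  · rw [← sub_eq_zero]
    refine eq_zero_of_sum_eq_zero (s := Finset.range (min l m + 1)) (e := fun k => l + m - 2 * k)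
      (v := fun k => ⁅X, Ck K n k F G⁆ - (Ck K n k ⁅X, F⁆ G + Ck K n k F ⁅X, G⁆))
      ?_ ?_ ?_ k (Finset.mem_range.mpr (by omega))
    · intro a ha b hb hab
      simp only [Finset.coe_range, Set.mem_Iio] at ha hb hab
      omega
    · intro k hk
      have hk : k ≤ min l m := Nat.lt_succ_iff.mp (Finset.mem_range.mp hk)
      exact sub_mem (homog_two_lie_mem hX (Ck_mem_homog hF hG hk))
        (add_mem (Ck_mem_homog hXF hG hk) (Ck_mem_homog hF hXG hk))
    · rw [Finset.sum_sub_distrib, Finset.sum_add_distrib, ← lie_sum, ← mul_eq_sum_Ck hF hG,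
        ← mul_eq_sum_Ck hXF hG, ← mul_eq_sum_Ck hF hXG]
      simp only [weyl_lie_def]
      noncomm_ring
  · rw [Ck_eq_zero hF hG (not_le.mp hk), Ck_eq_zero hXF hG (not_le.mp hk),
      Ck_eq_zero hF hXG (not_le.mp hk), lie_zero, add_zero]

/-! ### Cyclicity of the modules of homogeneous polynomials -/

/-- `ad (x_i x_j)` is a derivation of the commutative product. -/
theorem X_mul_X_lie_mul (i j : Fin n ⊕ Fin n) (F G : PolyAlg K n) :
    ⁅toWeyl K n (MvPolynomial.X i * MvPolynomial.X j), toWeyl K n (F * G)⁆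
      = toWeyl K n (F * (toWeyl K n).symm
          ⁅toWeyl K n (MvPolynomial.X i * MvPolynomial.X j), toWeyl K n G⁆
        + (MvPolynomial.X i * ham j F + MvPolynomial.X j * ham i F) * G) := by
  rw [X_mul_X_lie, X_mul_X_lie, LinearEquiv.symm_apply_apply]
  simp only [Derivation.leibniz, smul_eq_mul]
  refine congrArg (toWeyl K n) ?_
  ring

/-- A `𝔤₀`-submodule of `W` that contains `p_i ^ r` contains all of `S^r`. -/
theorem homog_le_of_pow_mem (N : LieSubmodule K (g0 K n) (Weyl K n)) (i : Fin n) {r : ℕ}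
    (hr : toWeyl K n (MvPolynomial.X (Sum.inl i) ^ r) ∈ N) : homog K n r ≤ N.toSubmodule := by
  -- The power of `p_i` is lowered step by step.
  suffices h : ∀ (c : ℕ) (F : PolyAlg K n), F.IsHomogeneous c → ∀ a, a + c = r →
      toWeyl K n (MvPolynomial.X (Sum.inl i) ^ a * F) ∈ N.toSubmodule by
    rintro _ ⟨F, hF, rfl⟩
    simpa using h r F hF 0 (zero_add r)
  intro c
  induction c with
  | zero =>
    rintro F hF a rfl
    obtain ⟨b, rfl⟩ := exists_C_of_homogeneous_zero hF
    rw [mul_comm, ← MvPolynomial.smul_eq_C_mul, map_smul]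
    exact N.toSubmodule.smul_mem b hr
  | succ c ih =>
    have step : ∀ (j : Fin n ⊕ Fin n) (G : PolyAlg K n), G.IsHomogeneous c → ∀ a, a + (c + 1) = r →
        toWeyl K n (MvPolynomial.X (Sum.inl i) ^ a * (MvPolynomial.X j * G)) ∈ N.toSubmodule := by
      intro j G hG a ha
      have hX : toWeyl K n (MvPolynomial.X j * MvPolynomial.X (Sum.inr i)) ∈ homog K n 2 :=
        toWeyl_mem_homog.mpr
          ((MvPolynomial.isHomogeneous_X K j).mul (MvPolynomial.isHomogeneous_X K _))
      have h1 := N.lie_mem (x := ⟨_, hX⟩) (ih G hG (a + 1) (by omega))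
      obtain ⟨G', hG', hGG'⟩ := homog_two_lie_mem hX (toWeyl_mem_homog.mpr hG)
      have h2 := ih G' hG' (a + 1) (by omega)
      change ⁅toWeyl K n (MvPolynomial.X j * MvPolynomial.X (Sum.inr i)), _⁆ ∈ N.toSubmodule at h1
      rw [X_mul_X_lie_mul, ← hGG', LinearEquiv.coe_coe, LinearEquiv.symm_apply_apply, map_add,
        Submodule.add_mem_iff_right _ h2] at h1
      -- The two terms of the derivation add up for `x_j = q_i`, and do not cancel.
      obtain ⟨b, hb, hbe⟩ : ∃ b : K, b ≠ 0 ∧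
          (MvPolynomial.X j * ham (Sum.inr i) (MvPolynomial.X (Sum.inl i) : PolyAlg K n)
            + MvPolynomial.X (Sum.inr i) * ham j (MvPolynomial.X (Sum.inl i)))
            = b • MvPolynomial.X j := by
        classical
        by_cases hj : j = Sum.inr i
        · subst hj
          refine ⟨-2, by norm_num, ?_⟩
          simp only [ham, Derivation.neg_apply, MvPolynomial.pderiv_X_self]
          rw [neg_smul, two_smul]
          ring
        · refine ⟨-1, by norm_num, ?_⟩
          have hz : ham j (MvPolynomial.X (Sum.inl i) : PolyAlg K n) = 0 := by
            rcases j with j | j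
            · exact MvPolynomial.pderiv_X_of_ne (by simp)
            · simp only [ham, Derivation.neg_apply, neg_eq_zero]
              exact MvPolynomial.pderiv_X_of_ne fun h => hj (by cases h; rfl)
          rw [hz]
          simp [ham]
      have h3 : ((MvPolynomial.X j * ham (Sum.inr i)
              ((MvPolynomial.X (Sum.inl i) : PolyAlg K n) ^ (a + 1))
            + MvPolynomial.X (Sum.inr i) * ham j (MvPolynomial.X (Sum.inl i) ^ (a + 1))) * G)
          = (((a + 1 : ℕ) : K) * b) •
            (MvPolynomial.X (Sum.inl i) ^ a * (MvPolynomial.X j * G)) := by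
        have h4 : ∀ D : Derivation K (PolyAlg K n) (PolyAlg K n),
            D (MvPolynomial.X (Sum.inl i) ^ (a + 1))
              = ((a + 1 : ℕ) : K) •
                (MvPolynomial.X (Sum.inl i) ^ a * D (MvPolynomial.X (Sum.inl i))) := by
          intro D
          rw [Derivation.leibniz_pow, Nat.cast_smul_eq_nsmul, Nat.add_sub_cancel, smul_eq_mul]
        rw [h4, h4, mul_smul]
        have h5 : b • ((MvPolynomial.X (Sum.inl i) : PolyAlg K n) ^ a * (MvPolynomial.X j * G))
            = MvPolynomial.X (Sum.inl i) ^ a * (b • MvPolynomial.X j) * G := by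
          rw [mul_smul_comm, smul_mul_assoc, mul_assoc]
        rw [h5, ← hbe]
        simp only [MvPolynomial.smul_eq_C_mul]
        ring
      rw [h3, map_smul] at h1
      exact (N.toSubmodule.smul_mem_iff
        (mul_ne_zero (Nat.cast_ne_zero.mpr a.succ_ne_zero) hb)).mp h1
    intro F hF a ha
    rw [eq_smul_sum_X_mul_pderiv hF, mul_smul_comm, Finset.mul_sum, map_smul, map_sum]
    exact N.toSubmodule.smul_mem _ (Submodule.sum_mem _ fun j _ => step j _ hF.pderiv a ha)

/-! ### Images of combinations of the coefficients -/

/-- If a `𝔤₀`-submodule contains all values on `S^l × S^m` of the combination `∑ ε_k C_k`, then it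
contains `S^(l + m - 2 k)` for every `k ≤ min l m` with `ε_k ≠ 0`. -/
theorem homog_le_of_Ck_sum_mem (i : Fin n) {l m : ℕ} (ε : ℕ → K)
    (N : LieSubmodule K (g0 K n) (Weyl K n))
    (hN : ∀ F ∈ homog K n l, ∀ G ∈ homog K n m,
      ∑ k ∈ Finset.range (min l m + 1), ε k • Ck K n k F G ∈ N)
    {k : ℕ} (hk : k ≤ min l m) (hε : ε k ≠ 0) : homog K n (l + m - 2 * k) ≤ N.toSubmodule := by
  induction k using Nat.strong_induction_on with
  | _ k ih =>
  apply homog_le_of_pow_mem N i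
  have hF : toWeyl K n (MvPolynomial.X (Sum.inl i) ^ l) ∈ homog K n l :=
    toWeyl_mem_homog.mpr (MvPolynomial.isHomogeneous_X_pow _ _)
  have hG : toWeyl K n
      (MvPolynomial.X (Sum.inl i) ^ (m - k) * MvPolynomial.X (Sum.inr i) ^ k) ∈ homog K n m := by
    have := (MvPolynomial.isHomogeneous_X_pow (R := K) (Sum.inl i : Fin n ⊕ Fin n) (m - k)).mul
      (MvPolynomial.isHomogeneous_X_pow (R := K) (Sum.inr i : Fin n ⊕ Fin n) k)
    rw [show m - k + k = m by omega] at this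
    exact toWeyl_mem_homog.mpr this
  have h := hN _ hF _ hG
  set F := toWeyl K n (MvPolynomial.X (Sum.inl i) ^ l)
  set G := toWeyl K n (MvPolynomial.X (Sum.inl i) ^ (m - k) * MvPolynomial.X (Sum.inr i) ^ k)
  have hkr : k ∈ Finset.range (min l m + 1) := Finset.mem_range.mpr (by omega)
  have hother : ∑ j ∈ (Finset.range (min l m + 1)).erase k, ε j • Ck K n j F G
      ∈ N.toSubmodule := by
    refine Submodule.sum_mem _ fun j hj => ?_
    obtain ⟨hjk, hj⟩ := Finset.mem_erase.mp hj
    have hj : j ≤ min l m := Nat.lt_succ_iff.mp (Finset.mem_range.mp hj)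
    rcases lt_or_gt_of_ne hjk with hlt | hgt
    · by_cases h0 : ε j = 0
      · rw [h0, zero_smul]
        exact N.toSubmodule.zero_mem
      · exact N.toSubmodule.smul_mem _ (ih j hlt hj h0 (Ck_mem_homog hF hG hj))
    · have hz : Ck K n j F G = 0 := by
        rw [Ck_apply, moyalCoeff, LinearMap.smul_apply, LinearMap.comp_apply, wp_pow_pow_tmul,
          Nat.descFactorial_eq_zero_iff_lt.mpr hgt]
        simp
      rw [hz, smul_zero]
      exact N.toSubmodule.zero_mem
  rw [← Finset.add_sum_erase _ _ hkr] at h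
  have h1 : ε k • Ck K n k F G ∈ N.toSubmodule := (Submodule.add_mem_iff_left _ hother).mp h
  obtain ⟨b, hb, hbe⟩ : ∃ b : K, b ≠ 0 ∧
      Ck K n k F G = b • toWeyl K n (MvPolynomial.X (Sum.inl i) ^ (l + m - 2 * k)) := by
    refine ⟨1 / ((2 : K) ^ k * (k.factorial : K)) *
      ((l.descFactorial k * k.descFactorial k : ℕ) : K), ?_, ?_⟩
    · refine mul_ne_zero (one_div_ne_zero (mul_ne_zero (pow_ne_zero _ two_ne_zero)
        (Nat.cast_ne_zero.mpr k.factorial_ne_zero))) (Nat.cast_ne_zero.mpr (mul_ne_zero ?_ ?_)) <;>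
      · rw [Ne, Nat.descFactorial_eq_zero_iff_lt]
        omega
    · rw [Ck_apply, moyalCoeff, LinearMap.smul_apply, LinearMap.comp_apply, wp_pow_pow_tmul,
        (LinearMap.mul' K (PolyAlg K n)).map_smul, LinearMap.mul'_apply, smul_smul, map_smul,
        Nat.sub_self, pow_zero, mul_one, ← pow_add, show l - k + (m - k) = l + m - 2 * k by omega]
  rw [hbe, smul_smul] at h1
  exact (N.toSubmodule.smul_mem_iff (mul_ne_zero hε hb)).mp h1

variable (K n) in
/-- The morphism of `𝔤₀`-modules `S^l ⊗ S^m → W` defined by a bilinear map on `W` for which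
the elements of `S²` act by derivations on `S^l × S^m`. -/
def tensorLift (β : Weyl K n →ₗ[K] Weyl K n →ₗ[K] Weyl K n) (l m : ℕ)
    (hβ : ∀ X ∈ homog K n 2, ∀ F ∈ homog K n l, ∀ G ∈ homog K n m,
      ⁅X, β F G⁆ = β ⁅X, F⁆ G + β F ⁅X, G⁆) :
    S K n l ⊗[K] S K n m →ₗ⁅K, g0 K n⁆ Weyl K n where
  __ := TensorProduct.lift β ∘ₗ
    TensorProduct.map ((S K n l).incl : S K n l →ₗ[K] Weyl K n)
      ((S K n m).incl : S K n m →ₗ[K] Weyl K n)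
  map_lie' := by
    intro X z
    change (TensorProduct.lift β ∘ₗ TensorProduct.map ((S K n l).incl : S K n l →ₗ[K] Weyl K n)
        ((S K n m).incl : S K n m →ₗ[K] Weyl K n)) ⁅X, z⁆
      = ⁅X, (TensorProduct.lift β ∘ₗ TensorProduct.map ((S K n l).incl : S K n l →ₗ[K] Weyl K n)
        ((S K n m).incl : S K n m →ₗ[K] Weyl K n)) z⁆
    induction z with
    | zero => simp
    | add x y hx hy => rw [lie_add, map_add, map_add, lie_add, hx, hy]
    | tmul F G =>
      rw [TensorProduct.LieModule.lie_tmul_right, map_add]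
      exact (hβ X X.2 F F.2 G G.2).symm

theorem tensorLift_tmul (β : Weyl K n →ₗ[K] Weyl K n →ₗ[K] Weyl K n) (l m : ℕ)
    (hβ : ∀ X ∈ homog K n 2, ∀ F ∈ homog K n l, ∀ G ∈ homog K n m,
      ⁅X, β F G⁆ = β ⁅X, F⁆ G + β F ⁅X, G⁆) (F : S K n l) (G : S K n m) :
    tensorLift K n β l m hβ (F ⊗ₜ G) = β F G := rfl

theorem range_tensorLift (β : Weyl K n →ₗ[K] Weyl K n →ₗ[K] Weyl K n) (l m : ℕ)
    (hβ : ∀ X ∈ homog K n 2, ∀ F ∈ homog K n l, ∀ G ∈ homog K n m,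
      ⁅X, β F G⁆ = β ⁅X, F⁆ G + β F ⁅X, G⁆) :
    (tensorLift K n β l m hβ).range.toSubmodule = imageHomog β l m :=
  (LieModuleHom.toSubmodule_range _).trans
    (TensorProduct.map₂_eq_range_lift_comp_mapIncl β (homog K n l) (homog K n m)).symm

/-- A combination `∑ ε_k C_k` induces a morphism of `𝔤₀`-modules on `S^l ⊗ S^m`, with image the
direct sum of the `S^(l + m - 2 k)` with `k ≤ min l m` and `ε_k ≠ 0`. These `k` are enumerated
by `e`. -/
theorem imageHomog_eq_iSup (i : Fin n) {l m : ℕ} (ε : ℕ → K)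
    (β : Weyl K n →ₗ[K] Weyl K n →ₗ[K] Weyl K n)
    (hβ : ∀ F ∈ homog K n l, ∀ G ∈ homog K n m,
      β F G = ∑ k ∈ Finset.range (min l m + 1), ε k • Ck K n k F G)
    {ι : Type*} (e : ι → ℕ) (he : ∀ k, (k ≤ min l m ∧ ε k ≠ 0) ↔ ∃ a, e a = k) :
    ∃ f : S K n l ⊗[K] S K n m →ₗ⁅K, g0 K n⁆ Weyl K n,
      (∀ (F : S K n l) (G : S K n m), f (F ⊗ₜ G) = β F G) ∧
      f.range.toSubmodule = imageHomog β l m ∧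
      imageHomog β l m = ⨆ a, homog K n (l + m - 2 * e a) := by
  have hlie : ∀ X ∈ homog K n 2, ∀ F ∈ homog K n l, ∀ G ∈ homog K n m,
      ⁅X, β F G⁆ = β ⁅X, F⁆ G + β F ⁅X, G⁆ := by
    intro X hX F hF G hG
    rw [hβ F hF G hG, hβ _ (homog_two_lie_mem hX hF) G hG, hβ F hF _ (homog_two_lie_mem hX hG),
      lie_sum, ← Finset.sum_add_distrib]
    refine Finset.sum_congr rfl fun k _ => ?_
    rw [lie_smul, lie_Ck hX hF hG, smul_add]
  refine ⟨tensorLift K n β l m hlie, tensorLift_tmul β l m hlie, range_tensorLift β l m hlie,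
    le_antisymm ?_ ?_⟩
  · refine Submodule.map₂_le.mpr fun F hF G hG => ?_
    rw [hβ F hF G hG]
    refine Submodule.sum_mem _ fun k hk => ?_
    have hk : k ≤ min l m := Nat.lt_succ_iff.mp (Finset.mem_range.mp hk)
    by_cases h0 : ε k = 0
    · rw [h0, zero_smul]
      exact Submodule.zero_mem _
    · obtain ⟨a, rfl⟩ := (he k).mp ⟨hk, h0⟩
      exact Submodule.smul_mem _ _ (Submodule.mem_iSup_of_mem a (Ck_mem_homog hF hG hk))
  · refine iSup_le fun a => ?_
    obtain ⟨hk, h0⟩ := (he _).mpr ⟨a, rfl⟩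
    rw [← range_tensorLift β l m hlie]
    refine homog_le_of_Ck_sum_mem i ε _ (fun F hF G hG => ?_) hk h0
    rw [← hβ F hF G hG]
    exact ⟨(⟨F, hF⟩ : S K n l) ⊗ₜ[K] (⟨G, hG⟩ : S K n m), rfl⟩

theorem isInternalSum_homog {l m : ℕ} {ι : Type*} {e : ι → ℕ} (he : Function.Injective e)
    (hle : ∀ a, e a ≤ min l m) {N : Submodule K (Weyl K n)}
    (hN : N = ⨆ a, homog K n (l + m - 2 * e a)) :
    IsInternalSum N (fun a => homog K n (l + m - 2 * e a)) := by
  refine ⟨homog_iSupIndep.comp (f := fun a => l + m - 2 * e a) fun a b hab => he ?_, hN⟩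
  have ha := hle a
  have hb := hle b
  simp only at hab
  omega

theorem lieBracket_eq_sum_Ck {l m : ℕ} {F G : Weyl K n} (hF : F ∈ homog K n l)
    (hG : G ∈ homog K n m) :
    lieBracket K n F G
      = ∑ k ∈ Finset.range (min l m + 1), (1 - (-1 : K) ^ k) • Ck K n k F G := by
  rw [lieBracket_apply, weyl_lie_def, mul_eq_sum_Ck hF hG, mul_swap_eq_sum_Ck hF hG,
    ← Finset.sum_sub_distrib]
  exact Finset.sum_congr rfl fun k _ => by rw [sub_smul, one_smul]

theorem superBracket_eq_sum_Ck {l m : ℕ} {F G : Weyl K n} (hF : F ∈ homog K n l)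
    (hG : G ∈ homog K n m) :
    superBracket K n F G
      = ∑ k ∈ Finset.range (min l m + 1), (1 - (-1 : K) ^ (l * m + k)) • Ck K n k F G := by
  rw [superBracket_of_mem hF hG, mul_eq_sum_Ck hF hG, mul_swap_eq_sum_Ck hF hG,
    Finset.smul_sum, ← Finset.sum_sub_distrib]
  exact Finset.sum_congr rfl fun k _ => by rw [sub_smul, one_smul, smul_smul, pow_add]

theorem one_sub_neg_one_pow_ne_zero_iff {k : ℕ} : 1 - (-1 : K) ^ k ≠ 0 ↔ Odd k := by
  rcases Nat.even_or_odd k with h | h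
  · simp [h.neg_one_pow, Nat.not_odd_iff_even.mpr h]
  · simp only [h.neg_one_pow, h, iff_true]
    norm_num

end MoyalWeyl

end

open MoyalWeyl in
theorem theorem3p1 {K : Type*} [Field K] [CharZero K] (n : ℕ) (hn : 0 < n) (l m : ℕ) :
    -- (1) the Moyal product
    (∃ f : S K n l ⊗[K] S K n m →ₗ⁅K, g0 K n⁆ Weyl K n,
      (∀ (F : S K n l) (G : S K n m), f (F ⊗ₜ G) = (F : Weyl K n) * (G : Weyl K n)) ∧
      IsInternalSum f.range.toSubmodule
        (fun k : {k : ℕ // k ≤ min l m} => homog K n (l + m - 2 * k.1)) ∧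
      IsInternalSum (imageHomog (LinearMap.mul K (Weyl K n)) l m)
        (fun k : {k : ℕ // k ≤ min l m} => homog K n (l + m - 2 * k.1))) ∧
    -- (2) the bracket of the Lie algebra `W`
    (∃ f : S K n l ⊗[K] S K n m →ₗ⁅K, g0 K n⁆ Weyl K n,
      (∀ (F : S K n l) (G : S K n m), f (F ⊗ₜ G) = lieBracket K n F G) ∧
      IsInternalSum f.range.toSubmodule
        (fun p : {p : ℕ // 2 * p + 1 ≤ min l m} => homog K n (l + m - 2 * (2 * p.1 + 1))) ∧
      IsInternalSum (imageHomog (lieBracket K n) l m)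
        (fun p : {p : ℕ // 2 * p + 1 ≤ min l m} => homog K n (l + m - 2 * (2 * p.1 + 1)))) ∧
    -- (3) the bracket of the Lie superalgebra `W`
    (∃ f : S K n l ⊗[K] S K n m →ₗ⁅K, g0 K n⁆ Weyl K n,
      (∀ (F : S K n l) (G : S K n m), f (F ⊗ₜ G) = superBracket K n F G) ∧
      (Even (l * m) →
        IsInternalSum f.range.toSubmodule
          (fun p : {p : ℕ // 2 * p + 1 ≤ min l m} => homog K n (l + m - 2 * (2 * p.1 + 1))) ∧
        IsInternalSum (imageHomog (superBracket K n) l m)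
          (fun p : {p : ℕ // 2 * p + 1 ≤ min l m} => homog K n (l + m - 2 * (2 * p.1 + 1)))) ∧
      (Odd (l * m) →
        IsInternalSum f.range.toSubmodule
          (fun p : {p : ℕ // 2 * p ≤ min l m} => homog K n (l + m - 4 * p.1)) ∧
        IsInternalSum (imageHomog (superBracket K n) l m)
          (fun p : {p : ℕ // 2 * p ≤ min l m} => homog K n (l + m - 4 * p.1)))) ∧
    -- (4) the coefficients of the Moyal product
    (∀ k : ℕ, ∃ f : S K n l ⊗[K] S K n m →ₗ⁅K, g0 K n⁆ Weyl K n,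
      (∀ (F : S K n l) (G : S K n m), f (F ⊗ₜ G) = Ck K n k F G) ∧
      (k ≤ min l m →
        f.range.toSubmodule = homog K n (l + m - 2 * k) ∧
        imageHomog (Ck K n k) l m = homog K n (l + m - 2 * k)) ∧
      (min l m < k → f = 0 ∧ imageHomog (Ck K n k) l m = ⊥)) := by
  obtain ⟨i⟩ : Nonempty (Fin n) := ⟨⟨0, hn⟩⟩
  have odd_enum : ∀ k, (k ≤ min l m ∧ Odd k) ↔
      ∃ p : {p : ℕ // 2 * p + 1 ≤ min l m}, 2 * p.1 + 1 = k := by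
    refine fun k => ⟨?_, ?_⟩
    · rintro ⟨hk, p, rfl⟩
      exact ⟨⟨p, hk⟩, rfl⟩
    · rintro ⟨p, rfl⟩
      exact ⟨p.2, p.1, rfl⟩
  have odd_inj : Function.Injective
      (fun p : {p : ℕ // 2 * p + 1 ≤ min l m} => 2 * p.1 + 1) := fun a b hab =>
    Subtype.ext (by simp only at hab; omega)
  have even_enum : ∀ k, (k ≤ min l m ∧ Even k) ↔
      ∃ p : {p : ℕ // 2 * p ≤ min l m}, 2 * p.1 = k := by
    refine fun k => ⟨?_, ?_⟩
    · rintro ⟨hk, hk'⟩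
      obtain ⟨p, rfl⟩ := hk'.two_dvd
      exact ⟨⟨p, hk⟩, rfl⟩
    · rintro ⟨p, rfl⟩
      exact ⟨p.2, even_two_mul p.1⟩
  have even_inj : Function.Injective (fun p : {p : ℕ // 2 * p ≤ min l m} => 2 * p.1) :=
    fun a b hab => Subtype.ext (by simp only at hab; omega)
  refine ⟨?_, ?_, ?_, ?_⟩
  · obtain ⟨f, hf, hr, h⟩ := imageHomog_eq_iSup i (l := l) (m := m) (fun _ => (1 : K))
      (LinearMap.mul K (Weyl K n)) (fun F hF G hG => by simpa using mul_eq_sum_Ck hF hG)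
      (fun k : {k : ℕ // k ≤ min l m} => k.1) (fun k => by simp)
    have hs := isInternalSum_homog Subtype.val_injective (fun k => k.2) h
    exact ⟨f, hf, hr ▸ hs, hs⟩
  · obtain ⟨f, hf, hr, h⟩ := imageHomog_eq_iSup i _ (lieBracket K n)
      (fun F hF G hG => lieBracket_eq_sum_Ck (l := l) (m := m) hF hG)
      (fun p : {p : ℕ // 2 * p + 1 ≤ min l m} => 2 * p.1 + 1)
      (fun k => by rw [one_sub_neg_one_pow_ne_zero_iff, odd_enum])
    have hs := isInternalSum_homog odd_inj (fun p => p.2) h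
    exact ⟨f, hf, hr ▸ hs, hs⟩
  · rcases Nat.even_or_odd (l * m) with hlm | hlm
    · obtain ⟨f, hf, hr, h⟩ := imageHomog_eq_iSup i _ (superBracket K n)
        (fun F hF G hG => superBracket_eq_sum_Ck (l := l) (m := m) hF hG)
        (fun p : {p : ℕ // 2 * p + 1 ≤ min l m} => 2 * p.1 + 1)
        (fun k => by
          rw [one_sub_neg_one_pow_ne_zero_iff, ← odd_enum, Nat.odd_add', iff_true_right hlm])
      have hs := isInternalSum_homog odd_inj (fun p => p.2) h
      exact ⟨f, hf, fun _ => ⟨hr ▸ hs, hs⟩, fun h => (Nat.not_odd_iff_even.mpr hlm h).elim⟩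
    · obtain ⟨f, hf, hr, h⟩ := imageHomog_eq_iSup i _ (superBracket K n)
        (fun F hF G hG => superBracket_eq_sum_Ck (l := l) (m := m) hF hG)
        (fun p : {p : ℕ // 2 * p ≤ min l m} => 2 * p.1)
        (fun k => by
          rw [one_sub_neg_one_pow_ne_zero_iff, ← even_enum, Nat.odd_add, iff_true_left hlm])
      have hs := isInternalSum_homog even_inj (fun p => p.2) h
      simp only [← mul_assoc] at hs
      exact ⟨f, hf, fun h => (Nat.not_odd_iff_even.mpr h hlm).elim, fun _ => ⟨hr ▸ hs, hs⟩⟩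
  · intro k
    by_cases hk : k ≤ min l m
    · obtain ⟨f, hf, hr, h⟩ := imageHomog_eq_iSup i (l := l) (m := m)
        (fun j => if j = k then (1 : K) else 0) (Ck K n k)
        (fun F hF G hG => by simp [hk])
        (fun _ : Unit => k) (fun j => by
          constructor
          · rintro ⟨_, hj⟩
            exact ⟨(), by by_contra hne; exact hj (if_neg (Ne.symm hne))⟩
          · rintro ⟨_, rfl⟩
            exact ⟨hk, by simp⟩)
      rw [iSup_const] at h
      exact ⟨f, hf, fun _ => ⟨hr.trans h, h⟩, fun hk' => (hk'.not_ge hk).elim⟩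
    · obtain ⟨f, hf, hr, h⟩ := imageHomog_eq_iSup i (l := l) (m := m) (fun _ => (0 : K))
        (Ck K n k) (fun F hF G hG => by simp [Ck_eq_zero hF hG (not_le.mp hk)])
        (fun a : Empty => a.elim) (fun j => by simp)
      rw [iSup_of_empty] at h
      refine ⟨f, hf, fun hk' => (hk hk').elim, fun _ => ⟨?_, h⟩⟩
      have hbot : f.range.toSubmodule = ⊥ := hr.trans h
      ext z
      exact (Submodule.mem_bot K).mp (hbot ▸ (⟨z, rfl⟩ : f z ∈ f.range))
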